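/- For a connected graph $G$ with $n$ vertices let $\delta$ and $\Delta$ be its minimum and maximum degree, let $\mu_1\ge\mu_2\ge\dots\ge\mu_n$ be the eigenvalues of its adjacency matrix, and let $\lambda=\max_{2\le i\le n}|\mu_i|$. A sequence $(G_n)_{n\ge 1}$ of connected graphs, where $G_n$ has $n$ vertices and parameters $\delta_n,\Delta_n,\lambda_n$, is called an expander sequence if $\Delta_n/\delta_n=1+o(1)$ and $\lambda_n=o(\Delta_n)$ as $n\to\infty$. Let $q\in(0,1]$. Consider the following protocols, which proceed in rounds and start with a single informed vertex $v$ of $G$. In every round of push, every informed vertex calls an independently and uniformly chosen neighbour, and the called vertex becomes informed if the transmission succeeds. In every round of pull, every uninformed vertex calls an independently and uniformly chosen neighbour, and if the called vertex was informed at the beginning of the round, then the caller becomes informed if the transmission succeeds. In every round of push&pull (pp), every vertex calls an independently and uniformly chosen neighbour, and if exactly one of the two vertices was informed at the beginning of the round, then the other one becomes informed if the transmission succeeds. Each transmission succeeds with probability $q$, independently of everything else, and all rounds are independent; informed vertices stay informed. For $\mathcal P\in\{push,pull,pp\}$ let $T_{\mathcal P}(G,v,q)$ be the number of rounds until all vertices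 of $G$ are informed. For $q\in(0,1)$ put $$c_{push}(q)=\frac1{\log(1+q)}+\frac1q,\qquad c_{pull}(q)=\frac1{\log(1+q)}-\frac1{\log(1-q)},\qquad c_{pp}(q)=\frac1{\log(1+2q)}+\frac1{q-\log(1-q)},$$ and $c_{\mathcal P}(1)=\lim_{q\uparrow1}c_{\mathcal P}(q)$, that is, $c_{push}(1)=\frac1{\log2}+1$, $c_{pull}(1)=\frac1{\log2}$, $c_{pp}(1)=\frac1{\log3}$. Theorem. Let $(G_n)_{n\ge1}$ be an expander sequence and let $q\in(0,1]$. Then, with probability $1-o(1)$ as $n\to\infty$, uniformly in the initially informed vertex $v$ of $G_n$, (a) $T_{push}(G_n,v,q)=c_{push}(q)\log n+o(\log n)$, (b) $T_{pull}(G_n,v,q)=c_{pull}(q)\log n+o(\log n)$, (c) $T_{pp}(G_n,v,q)=c_{pp}(q)\log n+o(\log n)$. That is, for each $\mathcal P\in\{push,pull,pp\}$ there is a function $g$ with $g(n)=o(\log n)$ such that $$\min_{v\in V(G_n)}\Pr\bigl[\,|T_{\mathcal P}(G_n,v,q)-c_{\mathcal P}(q)\log n|\le g(n)\,\bigr]\to1\quad\text{as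 } n\to\infty.$$ -/

import Mathlib

open MeasureTheory ProbabilityTheory Filter Asymptotics
open scoped Topology

namespace RumourSpreading

/-- The three broadcast protocols: *push*, *pull* and *push&pull*. -/
inductive Protocol
  | push
  | pull
  | pp

/-- The constants `c_push(q)`, `c_pull(q)`, `c_pp(q)`. For `q = 1` the value is the limit
`q → 1` from below of the formula for `q < 1`, see `tendsto_runtimeConst`. -/
noncomputable def runtimeConst : Protocol → ℝ → ℝ
  | .push, q => 1 / Real.log (1 + q) + 1 / q
  | .pull, q =>
      if q = 1 then 1 / Real.log 2
      else 1 / Real.log (1 + q) - 1 / Real.log (1 - q)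
  | .pp, q =>
      if q = 1 then 1 / Real.log 3
      else 1 / Real.log (1 + 2 * q) + 1 / (q - Real.log (1 - q))

theorem tendsto_runtimeConst (P : Protocol) :
    Tendsto (runtimeConst P) (𝓝[<] 1) (𝓝 (runtimeConst P 1)) := by
  have hlog : Tendsto (fun q : ℝ => Real.log (1 - q)) (𝓝[<] 1) atBot := by
    refine Real.tendsto_log_nhdsGT_zero.comp ?_
    refine tendsto_nhdsWithin_iff.2 ⟨?_, ?_⟩
    · have : Tendsto (fun q : ℝ => 1 - q) (𝓝 1) (𝓝 (1 - 1)) :=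
        (continuous_const.sub continuous_id).tendsto 1
      rw [sub_self] at this
      exact this.mono_left nhdsWithin_le_nhds
    · filter_upwards [self_mem_nhdsWithin] with q hq
      exact sub_pos.2 (Set.mem_Iio.1 hq)
  have hid : Tendsto (fun q : ℝ => q) (𝓝[<] 1) (𝓝 1) := tendsto_id.mono_left nhdsWithin_le_nhds
  have h2 : Tendsto (fun q : ℝ => 1 / Real.log (1 + q)) (𝓝[<] 1) (𝓝 (1 / Real.log 2)) := by
    have h : Tendsto (fun q : ℝ => 1 + q) (𝓝[<] 1) (𝓝 2) := by
      convert hid.const_add 1 using 2; norm_num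
    exact tendsto_const_nhds.div (h.log (by norm_num)) (Real.log_pos (by norm_num)).ne'
  have h3 : Tendsto (fun q : ℝ => 1 / Real.log (1 + 2 * q)) (𝓝[<] 1) (𝓝 (1 / Real.log 3)) := by
    have h : Tendsto (fun q : ℝ => 1 + 2 * q) (𝓝[<] 1) (𝓝 3) := by
      convert (hid.const_mul 2).const_add 1 using 2; norm_num
    exact tendsto_const_nhds.div (h.log (by norm_num)) (Real.log_pos (by norm_num)).ne'
  have hne : ∀ᶠ q : ℝ in 𝓝[<] 1, q ≠ 1 := by
    filter_upwards [self_mem_nhdsWithin] with q hq using ne_of_lt hq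
  cases P with
  | push =>
    have hone : Tendsto (fun q : ℝ => 1 / q) (𝓝[<] 1) (𝓝 (1 / 1)) :=
      tendsto_const_nhds.div hid one_ne_zero
    have h := h2.add hone
    rw [show runtimeConst .push 1 = 1 / Real.log 2 + 1 / 1 by
      simp only [runtimeConst]; norm_num]
    exact h
  | pull =>
    have hz : Tendsto (fun q : ℝ => 1 / Real.log (1 - q)) (𝓝[<] 1) (𝓝 0) := by
      simpa [Function.comp_def] using tendsto_inv_atBot_zero.comp hlog
    have := h2.sub hz
    rw [sub_zero] at this
    simp only [runtimeConst, if_true]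
    refine this.congr' ?_
    filter_upwards [hne] with q hq
    simp [runtimeConst, hq]
  | pp =>
    have hz : Tendsto (fun q : ℝ => 1 / (q - Real.log (1 - q))) (𝓝[<] 1) (𝓝 0) := by
      have hneg : Tendsto (fun q : ℝ => -Real.log (1 - q)) (𝓝[<] 1) atTop :=
        tendsto_neg_atBot_atTop.comp hlog
      have h := hid.add_atTop hneg
      have h' := tendsto_inv_atTop_zero.comp h
      simpa [Function.comp_def, sub_eq_add_neg] using h'
    have := h3.add hz
    rw [add_zero] at this
    simp only [runtimeConst, if_true]
    refine this.congr' ?_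
    filter_upwards [hne] with q hq
    simp [runtimeConst, hq]

section Graph

variable {V : Type*} [Fintype V] [DecidableEq V] (G : SimpleGraph V) [DecidableRel G.Adj]

/-- `λ = max_{2 ≤ i ≤ n} |μ_i|`, where `μ_1 ≥ μ_2 ≥ ... ≥ μ_n` are the eigenvalues of the
adjacency matrix, with multiplicity; here they are indexed from `0` in decreasing order, so the
index `0` is left out. For at most one vertex the value is `0`. -/
noncomputable def secondEigenvalue : ℝ :=
  ⨆ i : {i : Fin (Fintype.card V) // i.val ≠ 0},
    |(G.isHermitian_adjMatrix ℝ).eigenvalues₀ i.val|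

end Graph

/-- An expander sequence `(G_n)_{n ≥ 1}`: `G_n` is a connected graph on `n` vertices,
`Δ_n / δ_n = 1 + o(1)` and `λ_n = o(Δ_n)`. (The graph with index `0` plays no role.) -/
structure IsExpanderSequence (G : ∀ n : ℕ, SimpleGraph (Fin n)) [∀ n, DecidableRel (G n).Adj] :
    Prop where
  connected : ∀ n, 1 ≤ n → (G n).Connected
  degree_ratio :
    Tendsto (fun n => ((G n).maxDegree : ℝ) / ((G n).minDegree : ℝ)) atTop (𝓝 1)
  eigenvalue : (fun n => secondEigenvalue (G n)) =o[atTop] fun n => ((G n).maxDegree : ℝ)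

/-- What happens at every vertex in one round: `ω u = (w, b)` means that `u` calls `w` and `b`
says whether the message transmission along this call is successful. -/
abbrev Round (V : Type*) := V → V × Bool

section Dynamics

variable {V : Type*} [Fintype V] [DecidableEq V]

/-- The set of informed vertices after one round with calls `ω`, started from the informed
set `I`. In push, the informed vertices use their calls to inform the called vertex; in pull, the
uninformed vertices use theirs to get informed by the called vertex; push&pull does both. -/
def nextInformed : Protocol → Finset V → Round V → Finset V
  | .push, I, ω => I ∪ Finset.univ.filter (fun w => ∃ u ∈ I, ω u = (w, true))
  | .pull, I, ω => I ∪ Finset.univ.filter (fun u => (ω u).1 ∈ I ∧ (ω u).2 = true)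
  | .pp, I, ω => I ∪ Finset.univ.filter (fun w => ∃ u ∈ I, ω u = (w, true)) ∪
      Finset.univ.filter (fun u => (ω u).1 ∈ I ∧ (ω u).2 = true)

/-- The set of informed vertices after `t` rounds, if initially only `v` is informed. -/
def informed (P : Protocol) (v : V) (ω : ℕ → Round V) : ℕ → Finset V
  | 0 => {v}
  | t + 1 => nextInformed P (informed P v ω t) (ω t)

/-- The runtime: the number of rounds until all vertices are informed, `⊤` if this never
happens. -/
noncomputable def runtime (P : Protocol) (v : V) (ω : ℕ → Round V) : ℕ∞ :=
  ⨅ (t : ℕ) (_ : informed P v ω t = Finset.univ), (t : ℕ∞)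

variable (G : SimpleGraph V) [DecidableRel G.Adj]

/-- The law of the vertex called by `u`: uniform on the neighbours of `u` (an isolated vertex,
which exists in a connected graph only if there is no other vertex, calls itself). -/
noncomputable def neighbourLaw (u : V) : PMF V :=
  if h : (G.neighborFinset u).Nonempty then PMF.uniformOfFinset (G.neighborFinset u) h
  else PMF.pure u

variable [MeasurableSpace V]

/-- The law of one round: all vertices independently call a uniformly random neighbour, and
each transmission independently succeeds with probability `q`. -/
noncomputable def roundLaw (q : unitInterval) : Measure (Round V) :=
  Measure.pi fun u => (neighbourLaw G u).toMeasure.prod (bernoulliMeasure true false q)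

/-- The law of the whole process: the rounds are independent and identically distributed. -/
noncomputable def processLaw (q : unitInterval) : Measure (ℕ → Round V) :=
  Measure.infinitePi fun _ : ℕ => roundLaw G q

instance isProbabilityMeasure_roundLaw (q : unitInterval) :
    IsProbabilityMeasure (roundLaw G q) := by
  unfold roundLaw; infer_instance

instance isProbabilityMeasure_processLaw (q : unitInterval) :
    IsProbabilityMeasure (processLaw G q) := by
  unfold processLaw; infer_instance

end Dynamics

end RumourSpreading

/-!
On an expander the number of edges inside a vertex set `I` is about `Δ |I|² / n`. Hence, as long as
`I` is small, the informed set grows by a factor of about `1 + c` per round (`c = q` for push and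
pull, `c = 2q` for push&pull), and as long as the uninformed set is small, it shrinks by a factor of
about `ρ = (1 - pullRate) * exp (-pushRate)`. This gives the two summands of the runtime,
`log n / log (1 + c)` and `log n / -log ρ`.

Upper bound: while only few vertices are informed, Chebyshev's inequality makes `|I|^(-s)` decay
exponentially in expectation at a rate close to `(1 + c)^(-s)`; the number of uninformed vertices is
then controlled by its expectation alone. Lower bound: the first moment of `|I|` shows that half of
the vertices are still uninformed after slightly less than `log n / log (1 + c)` rounds; since in
every round each uninformed vertex stays so with probability at least about `ρ`, Chebyshev's
inequality keeps the number of uninformed vertices above `n ρ^t / 2` for the next `t` rounds.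
-/

namespace RumourSpreading

/-! ### Elementary inequalities -/

theorem one_sub_sum_le_prod_one_sub {ι : Type*} (s : Finset ι) (f : ι → ℝ)
    (h : ∀ i ∈ s, f i ∈ Set.Icc (0 : ℝ) 1) : 1 - ∑ i ∈ s, f i ≤ ∏ i ∈ s, (1 - f i) := by
  classical
  induction s using Finset.induction_on with
  | empty => simp
  | insert a s ha ih =>
    obtain ⟨hfa, hfs⟩ := Finset.forall_mem_insert .. |>.1 h
    have hsum : 0 ≤ ∑ i ∈ s, f i := Finset.sum_nonneg fun i hi => (hfs i hi).1
    rw [Finset.sum_insert ha, Finset.prod_insert ha]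
    nlinarith [mul_le_mul_of_nonneg_left (ih hfs) (sub_nonneg.2 hfa.2), mul_nonneg hfa.1 hsum]

theorem exp_neg_le_one_sub_add_sq_div_two {x : ℝ} (hx : 0 ≤ x) :
    Real.exp (-x) ≤ 1 - x + x ^ 2 / 2 := by
  have hpos : 0 ≤ 1 - x + x ^ 2 / 2 := by nlinarith [sq_nonneg (x - 1)]
  rw [Real.exp_neg, inv_le_iff_one_le_mul₀ (Real.exp_pos x)]
  nlinarith [mul_le_mul_of_nonneg_left (Real.quadratic_le_exp_of_nonneg hx) hpos,
    sq_nonneg (x ^ 2)]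

theorem div_three_le_one_sub_exp_neg {x : ℝ} (hx0 : 0 ≤ x) (hx2 : x ≤ 2) :
    x / 3 ≤ 1 - Real.exp (-x) := by
  have hexp : Real.exp (-x) ≤ 1 / (1 + x) := by
    rw [Real.exp_neg, ← one_div]
    gcongr
    linarith [Real.add_one_le_exp x]
  have hrat : 1 / (1 + x) ≤ 1 - x / 3 := by
    rw [div_le_iff₀ (by linarith)]
    nlinarith
  linarith


theorem exp_neg_le_exp_neg_add_sub {x y : ℝ} (hx : 0 ≤ x) (hxy : x ≤ y) :
    Real.exp (-x) ≤ Real.exp (-y) + (y - x) := by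
  have hsplit : Real.exp (-y) = Real.exp (-x) * Real.exp (-(y - x)) := by
    rw [← Real.exp_add]
    ring_nf
  have hx1 : Real.exp (-x) ≤ 1 := Real.exp_le_one_iff.2 (by linarith)
  nlinarith [mul_le_mul_of_nonneg_left (Real.one_sub_le_exp_neg (y - x)) (Real.exp_pos (-x)).le]

theorem exp_neg_div_one_sub_le_one_sub {x : ℝ} (hx : x < 1) :
    Real.exp (-(x / (1 - x))) ≤ 1 - x := by
  have hpos : 0 < 1 - x := by linarith
  rw [← Real.le_log_iff_exp_le hpos]
  convert Real.one_sub_inv_le_log_of_pos hpos using 1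
  field_simp
  ring

/-! ### Degrees into a set -/

section DegreeIn

variable {V : Type*} [Fintype V] (G : SimpleGraph V) [DecidableRel G.Adj]

theorem minDegree_mul_card_le_sum_degree (S : Finset V) :
    (G.minDegree : ℝ) * S.card ≤ ∑ u ∈ S, (G.degree u : ℝ) := by
  rw [mul_comm, ← nsmul_eq_mul]
  exact Finset.card_nsmul_le_sum _ _ _ fun u _ => Nat.cast_le.2 (G.minDegree_le_degree u)

theorem sum_degree_le_maxDegree_mul_card (S : Finset V) :
    ∑ u ∈ S, (G.degree u : ℝ) ≤ G.maxDegree * S.card := by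
  rw [mul_comm, ← nsmul_eq_mul]
  exact Finset.sum_le_card_nsmul _ _ _ fun u _ => Nat.cast_le.2 (G.degree_le_maxDegree u)

variable [DecidableEq V]

/-- The number `|N(u) ∩ S|` of neighbours of `u` in `S`, as a real number. -/
noncomputable def degreeIn (S : Finset V) (u : V) : ℝ := (G.neighborFinset u ∩ S).card

theorem degreeIn_nonneg (S : Finset V) (u : V) : 0 ≤ degreeIn G S u := Nat.cast_nonneg _

theorem degreeIn_empty (u : V) : degreeIn G ∅ u = 0 := by simp [degreeIn]

theorem degreeIn_univ (u : V) : degreeIn G Finset.univ u = G.degree u := by simp [degreeIn]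

theorem degreeIn_singleton (u w : V) : degreeIn G {u} w = if G.Adj w u then 1 else 0 := by
  by_cases h : G.Adj w u
  · simp [degreeIn, h, Finset.inter_singleton_of_mem]
  · simp [degreeIn, h, Finset.inter_singleton_of_notMem]

theorem degreeIn_union_of_disjoint {S T : Finset V} (h : Disjoint S T) (u : V) :
    degreeIn G (S ∪ T) u = degreeIn G S u + degreeIn G T u := by
  rw [degreeIn, Finset.inter_union_distrib_left, Finset.card_union_of_disjoint
    (h.mono Finset.inter_subset_right Finset.inter_subset_right), Nat.cast_add]
  rfl

theorem degreeIn_add_degreeIn_compl (S : Finset V) (u : V) :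
    degreeIn G S u + degreeIn G Sᶜ u = G.degree u := by
  rw [← degreeIn_union_of_disjoint G disjoint_compl_right, Finset.union_compl, degreeIn_univ]

theorem degreeIn_le_degree (S : Finset V) (u : V) : degreeIn G S u ≤ G.degree u := by
  linarith [degreeIn_add_degreeIn_compl G S u, degreeIn_nonneg G Sᶜ u]

theorem degreeIn_le_maxDegree (S : Finset V) (u : V) : degreeIn G S u ≤ G.maxDegree :=
  (degreeIn_le_degree G S u).trans (Nat.cast_le.2 (G.degree_le_maxDegree u))

theorem degreeIn_eq_sum_ite (S : Finset V) (u : V) :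
    degreeIn G S u = ∑ w ∈ S, if G.Adj u w then 1 else 0 := by
  rw [degreeIn, Finset.sum_boole]
  congr 2
  ext w
  simp [and_comm]

theorem sum_degreeIn_comm (S T : Finset V) :
    ∑ u ∈ S, degreeIn G T u = ∑ w ∈ T, degreeIn G S w := by
  simp_rw [degreeIn_eq_sum_ite]
  rw [Finset.sum_comm]
  simp only [G.adj_comm]

theorem sum_degreeIn_singleton_sq (u : V) : ∑ w, degreeIn G {u} w ^ 2 = G.degree u := by
  simp_rw [← degreeIn_univ, degreeIn_eq_sum_ite G _ u, degreeIn_singleton, G.adj_comm u]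
  exact Finset.sum_congr rfl fun w _ => by split_ifs <;> norm_num

theorem adjMatrix_mulVec_indicator (S : Finset V) (u : V) :
    (G.adjMatrix ℝ).mulVec (fun w => if w ∈ S then 1 else 0) u = degreeIn G S u := by
  rw [G.adjMatrix_mulVec_apply, Finset.sum_boole, Finset.filter_mem_eq_inter, degreeIn]

end DegreeIn

/-! ### Spectral expansion bounds the second moment of `degreeIn` -/

section EigenCoord

variable {V : Type*} [Fintype V] [DecidableEq V] {A : Matrix V V ℝ} (hA : A.IsHermitian)

/-- The coordinates of a vector with respect to the orthonormal eigenbasis of a real symmetric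
matrix. -/
noncomputable def eigenCoord (x : V → ℝ) (i : V) : ℝ :=
  inner ℝ (hA.eigenvectorBasis i) (WithLp.toLp 2 x)

theorem eigenCoord_eq_dotProduct (x : V → ℝ) (i : V) :
    eigenCoord hA x i = x ⬝ᵥ ⇑(hA.eigenvectorBasis i) := by
  rw [eigenCoord, EuclideanSpace.inner_eq_star_dotProduct]
  simp

theorem eigenCoord_mulVec (x : V → ℝ) (i : V) :
    eigenCoord hA (A.mulVec x) i = hA.eigenvalues i * eigenCoord hA x i := by
  have hAT : A.transpose = A := by
    rw [← Matrix.conjTranspose_eq_transpose_of_trivial, hA.eq]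
  rw [eigenCoord_eq_dotProduct, eigenCoord_eq_dotProduct, dotProduct_comm,
    Matrix.dotProduct_mulVec, ← Matrix.mulVec_transpose, hAT, hA.mulVec_eigenvectorBasis,
    smul_dotProduct, smul_eq_mul, dotProduct_comm]

theorem sum_eigenCoord_mul (x y : V → ℝ) :
    ∑ i, eigenCoord hA x i * eigenCoord hA y i = x ⬝ᵥ y := by
  simp only [eigenCoord]
  simp_rw [real_inner_comm (WithLp.toLp 2 x)]
  rw [hA.eigenvectorBasis.sum_inner_mul_inner, EuclideanSpace.inner_eq_star_dotProduct]
  simp [dotProduct_comm]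

theorem sum_eigenCoord_sq (x : V → ℝ) : ∑ i, eigenCoord hA x i ^ 2 = x ⬝ᵥ x := by
  simp_rw [sq, sum_eigenCoord_mul]

theorem sum_eigenvalues_mul_eigenCoord_sq (x : V → ℝ) :
    ∑ i, hA.eigenvalues i * eigenCoord hA x i ^ 2 = A.mulVec x ⬝ᵥ x := by
  simp_rw [← sum_eigenCoord_mul hA, eigenCoord_mulVec, sq, mul_assoc]

theorem sum_eigenvectorBasis_sq (i : V) : ∑ u, hA.eigenvectorBasis i u ^ 2 = 1 := by
  rw [← EuclideanSpace.real_norm_sq_eq, OrthonormalBasis.norm_eq_one, one_pow]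

variable {i₀ : V} {D lam : ℝ}

theorem mulVec_dotProduct_mulVec_le (hD : |hA.eigenvalues i₀| ≤ D)
    (hlam : ∀ i ≠ i₀, |hA.eigenvalues i| ≤ lam) (x : V → ℝ) :
    A.mulVec x ⬝ᵥ A.mulVec x ≤ D ^ 2 * eigenCoord hA x i₀ ^ 2 + lam ^ 2 * (x ⬝ᵥ x) := by
  have hrest : ∑ i ∈ Finset.univ.erase i₀, hA.eigenvalues i ^ 2 * eigenCoord hA x i ^ 2 ≤
      lam ^ 2 * (x ⬝ᵥ x) := by
    rw [← sum_eigenCoord_sq hA x, Finset.mul_sum]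
    calc ∑ i ∈ Finset.univ.erase i₀, hA.eigenvalues i ^ 2 * eigenCoord hA x i ^ 2
        ≤ ∑ i ∈ Finset.univ.erase i₀, lam ^ 2 * eigenCoord hA x i ^ 2 :=
          Finset.sum_le_sum fun i hi => mul_le_mul_of_nonneg_right
            (sq_le_sq.2 ((hlam i (Finset.ne_of_mem_erase hi)).trans (le_abs_self _)))
            (sq_nonneg _)
      _ ≤ ∑ i, lam ^ 2 * eigenCoord hA x i ^ 2 :=
          Finset.sum_le_sum_of_subset_of_nonneg (Finset.subset_univ _) fun i _ _ => by positivity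
  rw [← sum_eigenCoord_sq hA]
  simp_rw [eigenCoord_mulVec, mul_pow]
  rw [← Finset.add_sum_erase _ _ (Finset.mem_univ i₀)]
  refine add_le_add (mul_le_mul_of_nonneg_right ?_ (sq_nonneg _)) hrest
  exact sq_le_sq.2 (hD.trans (le_abs_self _))

/-- A vector whose Rayleigh quotient is close to the top of the spectrum is almost parallel to the
leading eigenvector. -/
theorem mul_sub_eigenCoord_sq_le (hD : |hA.eigenvalues i₀| ≤ D)
    (hlam : ∀ i ≠ i₀, |hA.eigenvalues i| ≤ lam) {d : ℝ} {x : V → ℝ}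
    (hx : d * (x ⬝ᵥ x) ≤ A.mulVec x ⬝ᵥ x) :
    (D - lam) * (x ⬝ᵥ x - eigenCoord hA x i₀ ^ 2) ≤ (D - d) * (x ⬝ᵥ x) := by
  have hsum : eigenCoord hA x i₀ ^ 2 + ∑ i ∈ Finset.univ.erase i₀, eigenCoord hA x i ^ 2 =
      x ⬝ᵥ x := by
    rw [Finset.add_sum_erase _ (fun i => eigenCoord hA x i ^ 2) (Finset.mem_univ i₀),
      sum_eigenCoord_sq]
  have hrest : ∑ i ∈ Finset.univ.erase i₀, hA.eigenvalues i * eigenCoord hA x i ^ 2 ≤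
      lam * ∑ i ∈ Finset.univ.erase i₀, eigenCoord hA x i ^ 2 := by
    rw [Finset.mul_sum]
    refine Finset.sum_le_sum fun i hi => ?_
    gcongr
    exact (le_abs_self _).trans (hlam i (Finset.ne_of_mem_erase hi))
  have htop : hA.eigenvalues i₀ * eigenCoord hA x i₀ ^ 2 ≤ D * eigenCoord hA x i₀ ^ 2 := by
    gcongr
    exact (le_abs_self _).trans hD
  rw [← sum_eigenvalues_mul_eigenCoord_sq hA,
    ← Finset.add_sum_erase _ _ (Finset.mem_univ i₀)] at hx
  have hbound := hx.trans (add_le_add htop hrest)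
  rw [← hsum] at hbound ⊢
  linarith

end EigenCoord

section AlmostConstant

variable {V : Type*} [Fintype V] {v : V → ℝ}

theorem sum_sub_mean_sq [Nonempty V] (hv : ∑ u, v u ^ 2 = 1) :
    ∑ u, (v u - (∑ w, v w) / Fintype.card V) ^ 2 = 1 - (∑ w, v w) ^ 2 / Fintype.card V := by
  have hn : (Fintype.card V : ℝ) ≠ 0 := Nat.cast_ne_zero.2 Fintype.card_ne_zero
  set a := ∑ w, v w with ha
  simp_rw [sub_sq, Finset.sum_add_distrib, Finset.sum_sub_distrib, ← Finset.sum_mul,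
    ← Finset.mul_sum, hv, ← ha, Finset.sum_const, Finset.card_univ, nsmul_eq_mul]
  field_simp
  ring

/-- The mean of `v` contributes at most `|S|² / n` to the square, and Cauchy–Schwarz bounds the
deviation from the mean. -/
theorem sq_sum_le_of_almost_constant [Nonempty V] (hv : ∑ u, v u ^ 2 = 1) {b : ℝ} (hb : 0 ≤ b)
    (hvb : (1 - b ^ 2) * Fintype.card V ≤ (∑ u, v u) ^ 2) (S : Finset V) :
    (∑ u ∈ S, v u) ^ 2 ≤ S.card * (S.card / Fintype.card V + (2 * b + b ^ 2)) := by
  have hn : (0 : ℝ) < Fintype.card V := Nat.cast_pos.2 Fintype.card_pos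
  have hkn : (S.card : ℝ) ≤ Fintype.card V := Nat.cast_le.2 S.card_le_univ
  have hk : (0 : ℝ) ≤ S.card := Nat.cast_nonneg _
  have hcs : (∑ u, v u) ^ 2 ≤ Fintype.card V := by
    simpa [hv] using sq_sum_le_card_mul_sum_sq (s := Finset.univ) (f := v)
  have hdev := sum_sub_mean_sq hv
  set n : ℝ := (Fintype.card V : ℝ)
  set k : ℝ := (S.card : ℝ)
  set a := ∑ u, v u
  set z := ∑ u ∈ S, (v u - a / n)
  have hz : z ^ 2 ≤ k * b ^ 2 := by
    refine sq_sum_le_card_mul_sum_sq.trans (mul_le_mul_of_nonneg_left ?_ hk)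
    refine (Finset.sum_le_sum_of_subset_of_nonneg (Finset.subset_univ S)
      fun _ _ _ => sq_nonneg _).trans (hdev.trans_le ?_)
    rw [sub_le_comm, le_div_iff₀ hn]
    exact hvb
  have hmean : (a / n * k) ^ 2 ≤ k * (k / n) := by
    rw [show (a / n * k) ^ 2 = a ^ 2 * (k ^ 2 / n ^ 2) by ring,
      show k * (k / n) = n * (k ^ 2 / n ^ 2) by field_simp]
    gcongr
  have hcross : (a / n * k) * z ≤ k * b := by
    refine le_of_abs_le (abs_le_of_sq_le_sq ?_ (mul_nonneg hk hb))
    rw [mul_pow _ z, show (k * b) ^ 2 = k * (k * b ^ 2) by ring]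
    refine mul_le_mul (hmean.trans ?_) hz (sq_nonneg _) hk
    exact mul_le_of_le_one_right hk ((div_le_one hn).2 hkn)
  have hsplit : ∑ u ∈ S, v u = a / n * k + z := by
    simp only [z, Finset.sum_sub_distrib, Finset.sum_const, nsmul_eq_mul, k]
    ring
  rw [hsplit]
  nlinarith

end AlmostConstant

section Spectral

variable {V : Type*} [Fintype V] (G : SimpleGraph V) [DecidableRel G.Adj]

theorem minDegree_mul_card_le_adjMatrix_mulVec_one :
    (G.minDegree : ℝ) * ((1 : V → ℝ) ⬝ᵥ 1) ≤ (G.adjMatrix ℝ).mulVec 1 ⬝ᵥ 1 := by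
  simpa [dotProduct, G.adjMatrix_mulVec_apply] using
    minDegree_mul_card_le_sum_degree G Finset.univ

variable [DecidableEq V]

theorem abs_eigenvalues_adjMatrix_le_maxDegree (i : V) :
    |(G.isHermitian_adjMatrix ℝ).eigenvalues i| ≤ G.maxDegree := by
  have hspec := (G.isHermitian_adjMatrix ℝ).eigenvalues_mem_spectrum_real i
  rw [← Matrix.spectrum_toLin'] at hspec
  obtain ⟨u, hu⟩ := eigenvalue_mem_ball (Module.End.HasEigenvalue.of_mem_spectrum hspec)
  have hdeg : ∑ w ∈ Finset.univ.erase u, ‖G.adjMatrix ℝ u w‖ ≤ G.degree u := by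
    refine (Finset.sum_le_sum_of_subset_of_nonneg (Finset.subset_univ _)
      fun _ _ _ => norm_nonneg _).trans_eq ?_
    simp [SimpleGraph.adjMatrix_apply, apply_ite, ← degreeIn_univ, degreeIn_eq_sum_ite]
  rw [Metric.mem_closedBall, Real.dist_eq, SimpleGraph.adjMatrix_apply, if_neg (G.irrefl),
    sub_zero] at hu
  exact hu.trans (hdeg.trans (Nat.cast_le.2 (G.degree_le_maxDegree u)))

theorem exists_forall_ne_abs_eigenvalues_le_secondEigenvalue [Nonempty V] :
    ∃ i₀, ∀ i ≠ i₀, |(G.isHermitian_adjMatrix ℝ).eigenvalues i| ≤ secondEigenvalue G := by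
  let e : Fin (Fintype.card V) ≃ V := Fintype.equivOfCardEq (Fintype.card_fin _)
  refine ⟨e ⟨0, Fintype.card_pos⟩, fun i hi => ?_⟩
  have hne : (e.symm i).val ≠ 0 := fun h =>
    hi (e.symm_apply_eq.1 (Fin.ext h))
  exact le_ciSup (f := fun i : {i : Fin (Fintype.card V) // i.val ≠ 0} =>
    |(G.isHermitian_adjMatrix ℝ).eigenvalues₀ i.val|) (Set.finite_range _).bddAbove ⟨e.symm i, hne⟩

theorem secondEigenvalue_nonneg : 0 ≤ secondEigenvalue G :=
  Real.iSup_nonneg fun _ => abs_nonneg _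

theorem sum_degreeIn_sq_le [Nonempty V] {b : ℝ} (hb : 0 ≤ b)
    (hlt : secondEigenvalue G < G.maxDegree)
    (hgap : (G.maxDegree : ℝ) - G.minDegree ≤ b ^ 2 * (G.maxDegree - secondEigenvalue G))
    (S : Finset V) :
    ∑ u, degreeIn G S u ^ 2 ≤
      (G.maxDegree : ℝ) ^ 2 * (S.card * (S.card / Fintype.card V + (2 * b + b ^ 2))) +
        secondEigenvalue G ^ 2 * S.card := by
  obtain ⟨i₀, hi₀⟩ := exists_forall_ne_abs_eigenvalues_le_secondEigenvalue G
  set hA := G.isHermitian_adjMatrix ℝ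
  have hD := abs_eigenvalues_adjMatrix_le_maxDegree G i₀
  have hleading : (1 - b ^ 2) * Fintype.card V ≤ (∑ u, hA.eigenvectorBasis i₀ u) ^ 2 := by
    have hrayleigh := mul_sub_eigenCoord_sq_le hA hD hi₀
      (minDegree_mul_card_le_adjMatrix_mulVec_one G)
    simp only [eigenCoord_eq_dotProduct, dotProduct, Pi.one_apply, one_mul, Finset.sum_const,
      Finset.card_univ, nsmul_eq_mul, mul_one] at hrayleigh
    have hmul := mul_le_mul_of_nonneg_right hgap (Nat.cast_nonneg (α := ℝ) (Fintype.card V))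
    have := le_of_mul_le_mul_left ((hrayleigh.trans hmul).trans_eq
      (show _ = (G.maxDegree - secondEigenvalue G) * (b ^ 2 * Fintype.card V) by ring))
      (sub_pos.2 hlt)
    linarith
  set x : V → ℝ := fun u => if u ∈ S then 1 else 0 with hx
  have hcoord : eigenCoord hA x i₀ ^ 2 ≤
      S.card * (S.card / Fintype.card V + (2 * b + b ^ 2)) := by
    simpa [eigenCoord_eq_dotProduct, dotProduct, hx] using
      sq_sum_le_of_almost_constant (sum_eigenvectorBasis_sq hA i₀) hb hleading S
  have hmulVec : (G.adjMatrix ℝ).mulVec x = degreeIn G S :=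
    funext fun u => adjMatrix_mulVec_indicator G S u
  have hsq : ∑ u, degreeIn G S u ^ 2 = (G.adjMatrix ℝ).mulVec x ⬝ᵥ (G.adjMatrix ℝ).mulVec x := by
    simp only [hmulVec, dotProduct, sq]
  have hxx : x ⬝ᵥ x = S.card := by simp [dotProduct, hx]
  rw [hsq, ← hxx]
  refine (mulVec_dotProduct_mulVec_le hA hD hi₀ x).trans ?_
  rw [hxx]
  gcongr

/-- A quantitative form of near-regularity and expansion: the degrees are large and agree up to a
factor `1 + η`, and the second moments of the sizes of `N(u) ∩ S` are at most those in a random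
graph, up to an error `η`. -/
structure IsQuasirandom (η : ℝ) : Prop where
  minDegree_pos : 0 < G.minDegree
  maxDegree_le : (G.maxDegree : ℝ) ≤ (1 + η) * G.minDegree
  one_le : 1 ≤ η * G.minDegree
  mixing : ∀ S : Finset V, ∑ u, degreeIn G S u ^ 2 ≤
    (G.minDegree : ℝ) ^ 2 * (S.card * (S.card / Fintype.card V + η))

variable {G}

theorem IsQuasirandom.mono {η η' : ℝ} (h : IsQuasirandom G η) (hη : η ≤ η') :
    IsQuasirandom G η' where
  minDegree_pos := h.minDegree_pos
  maxDegree_le := h.maxDegree_le.trans (by gcongr)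
  one_le := h.one_le.trans (by gcongr)
  mixing S := (h.mixing S).trans (by gcongr)

theorem sum_degreeIn_sq_le_of_secondEigenvalue_le [Nonempty V] {θ : ℝ} (hθ0 : 0 < θ)
    (hθ : 100 * θ ≤ 1) (hδ : 0 < G.minDegree)
    (hdegree : (G.maxDegree : ℝ) ≤ (1 + θ ^ 2) * G.minDegree)
    (hlam : secondEigenvalue G ≤ θ * G.maxDegree) (S : Finset V) :
    ∑ u, degreeIn G S u ^ 2 ≤
      (G.minDegree : ℝ) ^ 2 * (S.card * (S.card / Fintype.card V + 50 * θ)) := by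
  have hlam0 := secondEigenvalue_nonneg G
  have hdD : (G.minDegree : ℝ) ≤ G.maxDegree := Nat.cast_le.2 G.minDegree_le_maxDegree
  have hd0 : (0 : ℝ) < G.minDegree := Nat.cast_pos.2 hδ
  have hmix := sum_degreeIn_sq_le G (b := 2 * θ) (by positivity)
  set lam := secondEigenvalue G
  set D : ℝ := (G.maxDegree : ℝ)
  set d : ℝ := (G.minDegree : ℝ)
  have hθsq : θ ^ 2 ≤ θ / 100 := by nlinarith
  have hgap : D - d ≤ (2 * θ) ^ 2 * (D - lam) := by
    have hlam_half : θ ^ 2 * lam ≤ θ ^ 2 * (1 / 2 * D) := by gcongr; nlinarith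
    have hdD_sq : θ ^ 2 * d ≤ θ ^ 2 * D := by gcongr
    linarith
  have hlamD : lam ^ 2 ≤ θ * D ^ 2 := by
    calc lam ^ 2 ≤ (θ * D) ^ 2 := by gcongr
      _ = θ ^ 2 * D ^ 2 := mul_pow _ _ _
      _ ≤ θ * D ^ 2 := by gcongr; linarith
  have hDd : D ^ 2 ≤ (1 + θ) * d ^ 2 := by
    calc D ^ 2 ≤ ((1 + θ ^ 2) * d) ^ 2 := by gcongr
      _ = (1 + θ ^ 2) ^ 2 * d ^ 2 := mul_pow _ _ _
      _ ≤ (1 + θ) * d ^ 2 := by gcongr; nlinarith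
  have hkn : (S.card : ℝ) / Fintype.card V ≤ 1 :=
    div_le_one_of_le₀ (Nat.cast_le.2 S.card_le_univ) (Nat.cast_nonneg _)
  set k : ℝ := (S.card : ℝ)
  set n : ℝ := (Fintype.card V : ℝ)
  calc ∑ u, degreeIn G S u ^ 2
      ≤ D ^ 2 * (k * (k / n + (2 * (2 * θ) + (2 * θ) ^ 2))) + lam ^ 2 * k :=
        hmix (by nlinarith) hgap S
    _ ≤ D ^ 2 * (k * (k / n + (2 * (2 * θ) + (2 * θ) ^ 2))) + θ * D ^ 2 * k := by gcongr
    _ = D ^ 2 * (k * (k / n + (5 * θ + 4 * θ ^ 2))) := by ring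
    _ ≤ (1 + θ) * d ^ 2 * (k * (k / n + (5 * θ + 4 * (θ / 100)))) := by gcongr
    _ = d ^ 2 * (k * (k / n + θ * (k / n) + (1 + θ) * (5 * θ + 4 * (θ / 100)))) := by ring
    _ ≤ d ^ 2 * (k * (k / n + θ * 1 + (1 + θ) * (5 * θ + 4 * (θ / 100)))) := by gcongr
    _ ≤ d ^ 2 * (k * (k / n + 50 * θ)) := by gcongr _ * (_ * ?_); nlinarith

theorem isQuasirandom_of_secondEigenvalue_le [Nonempty V] {θ : ℝ} (hθ0 : 0 < θ)
    (hθ : 100 * θ ≤ 1) (hn : 1 ≤ θ * Fintype.card V) (hδ : 0 < G.minDegree)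
    (hdegree : (G.maxDegree : ℝ) ≤ (1 + θ ^ 2) * G.minDegree)
    (hlam : secondEigenvalue G ≤ θ * G.maxDegree) : IsQuasirandom G (100 * θ) where
  minDegree_pos := hδ
  maxDegree_le := hdegree.trans (by gcongr; nlinarith)
  one_le := by
    -- Mixing for a single vertex bounds its degree by `δ² (1 / n + 50 θ)`, so `δ` must be large.
    obtain ⟨u⟩ := ‹Nonempty V›
    have hmix := sum_degreeIn_sq_le_of_secondEigenvalue_le hθ0 hθ hδ hdegree hlam {u}
    rw [sum_degreeIn_singleton_sq, Finset.card_singleton, Nat.cast_one, one_mul] at hmix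
    have hinv : (1 : ℝ) / Fintype.card V ≤ θ := div_le_of_le_mul₀ (Nat.cast_nonneg _) hθ0.le hn
    have hmul : (G.minDegree : ℝ) * 1 ≤ G.minDegree * (100 * θ * G.minDegree) :=
      calc (G.minDegree : ℝ) * 1 ≤ G.degree u := by
            rw [mul_one]; exact Nat.cast_le.2 (G.minDegree_le_degree u)
        _ ≤ (G.minDegree : ℝ) ^ 2 * (1 / Fintype.card V + 50 * θ) := hmix
        _ ≤ (G.minDegree : ℝ) ^ 2 * (100 * θ) := by gcongr; linarith
        _ = G.minDegree * (100 * θ * G.minDegree) := by ring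
    exact le_of_mul_le_mul_left hmul (Nat.cast_pos.2 hδ)
  mixing S := (sum_degreeIn_sq_le_of_secondEigenvalue_le hθ0 hθ hδ hdegree hlam S).trans
    (by gcongr; linarith)

end Spectral

theorem IsExpanderSequence.eventually_isQuasirandom {G : ∀ n : ℕ, SimpleGraph (Fin n)}
    [∀ n, DecidableRel (G n).Adj] (hG : IsExpanderSequence G) {η : ℝ} (hη : 0 < η) :
    ∀ᶠ n in atTop, IsQuasirandom (G n) η := by
  obtain ⟨θ, hθ0, hθη⟩ : ∃ θ : ℝ, 0 < θ ∧ 100 * θ ≤ min η 1 :=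
    ⟨min η 1 / 100, by positivity, by linarith⟩
  have hθ1 : 100 * θ ≤ 1 := hθη.trans (min_le_right η 1)
  have hratio := hG.degree_ratio.eventually (Metric.ball_mem_nhds (1 : ℝ) (pow_pos hθ0 2))
  have hlarge : ∀ᶠ n : ℕ in atTop, 1 / θ ≤ n := tendsto_natCast_atTop_atTop.eventually_ge_atTop _
  filter_upwards [hratio, hG.eigenvalue.def hθ0, hlarge, eventually_ge_atTop 1]
    with n hratio heig hlarge hn
  have : Nonempty (Fin n) := ⟨⟨0, hn⟩⟩
  rw [Real.norm_of_nonneg (secondEigenvalue_nonneg (G n)),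
    Real.norm_of_nonneg (Nat.cast_nonneg _)] at heig
  rw [Real.dist_eq] at hratio
  have hδ : 0 < (G n).minDegree := by
    refine Nat.pos_of_ne_zero fun h0 => ?_
    rw [h0, Nat.cast_zero, div_zero, zero_sub, abs_neg, abs_one] at hratio
    nlinarith
  refine (isQuasirandom_of_secondEigenvalue_le hθ0 hθ1 ?_ hδ ?_ heig).mono
    (hθη.trans (min_le_left η 1))
  · rw [Fintype.card_fin]
    rwa [div_le_iff₀' hθ0] at hlarge
  · have hlt := (abs_lt.1 hratio).2
    rw [sub_lt_iff_lt_add', div_lt_iff₀ (Nat.cast_pos.2 hδ)] at hlt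
    exact hlt.le

/-! ### One round -/

section Rates

/-- The success probability of a call made by an informed vertex. -/
def pushRate : Protocol → ℝ → ℝ
  | .push, q => q
  | .pull, _ => 0
  | .pp, q => q

/-- The success probability of a call made by an uninformed vertex. -/
def pullRate : Protocol → ℝ → ℝ
  | .push, _ => 0
  | .pull, q => q
  | .pp, q => q

/-- The relative growth per round of a small informed set. -/
def growthRate (P : Protocol) (q : ℝ) : ℝ := pushRate P q + pullRate P q

/-- The factor by which a small uninformed set shrinks per round. -/
noncomputable def shrinkRate (P : Protocol) (q : ℝ) : ℝ :=
  (1 - pullRate P q) * Real.exp (-pushRate P q)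

variable (P : Protocol) {q : ℝ}

theorem pushRate_mem_Icc (hq : q ∈ Set.Icc (0 : ℝ) 1) : pushRate P q ∈ Set.Icc (0 : ℝ) 1 := by
  cases P <;> simp [pushRate, hq.1, hq.2]

theorem pullRate_mem_Icc (hq : q ∈ Set.Icc (0 : ℝ) 1) : pullRate P q ∈ Set.Icc (0 : ℝ) 1 := by
  cases P <;> simp [pullRate, hq.1, hq.2]

theorem growthRate_pos (hq : 0 < q) : 0 < growthRate P q := by
  cases P <;> simp [growthRate, pushRate, pullRate, hq]

theorem growthRate_nonneg (hq : q ∈ Set.Icc (0 : ℝ) 1) : 0 ≤ growthRate P q :=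
  add_nonneg (pushRate_mem_Icc P hq).1 (pullRate_mem_Icc P hq).1

theorem growthRate_le_two (hq : q ∈ Set.Icc (0 : ℝ) 1) : growthRate P q ≤ 2 :=
  (add_le_add (pushRate_mem_Icc P hq).2 (pullRate_mem_Icc P hq).2).trans_eq one_add_one_eq_two

end Rates

section Combinatorics

variable {V : Type*} [DecidableEq V]

/-- If `I` is the set of informed vertices and `u` is uninformed, then `u` becomes informed iff
some `w` successfully calls a vertex of `callTargets P I w u`. -/
def callTargets (P : Protocol) (I : Finset V) (w u : V) : Finset V :=
  match P with
  | .push => if w ∈ I then {u} else ∅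
  | .pull => if w = u then I else ∅
  | .pp => if w = u then I else if w ∈ I then {u} else ∅

theorem disjoint_callTargets (P : Protocol) {I : Finset V} {u v : V} (huv : u ≠ v)
    (hu : u ∉ I) (hv : v ∉ I) (w : V) :
    Disjoint (callTargets P I w u) (callTargets P I w v) := by
  rw [Finset.disjoint_left]
  intro x
  cases P <;> simp only [callTargets] <;> split_ifs <;> simp_all

variable [Fintype V]

theorem subset_nextInformed (P : Protocol) (I : Finset V) (r : Round V) :
    I ⊆ nextInformed P I r := by
  intro x hx
  cases P <;> simp [nextInformed, hx]

theorem notMem_nextInformed_iff (P : Protocol) {I : Finset V} {u : V} (hu : u ∉ I) (r : Round V) :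
    u ∉ nextInformed P I r ↔ ∀ w, ¬ ((r w).1 ∈ callTargets P I w u ∧ (r w).2 = true) := by
  have hpush : u ∉ Finset.univ.filter (fun w => ∃ x ∈ I, r x = (w, true)) ↔
      ∀ w, w ∈ I → ¬ ((r w).1 = u ∧ (r w).2 = true) := by
    simp [Prod.ext_iff]
  cases P with
  | push =>
    rw [nextInformed, Finset.mem_union, not_or, hpush]
    refine (and_iff_right hu).trans (forall_congr' fun w => ?_)
    by_cases hw : w ∈ I <;> simp [callTargets, hw]
  | pull =>
    rw [nextInformed, Finset.mem_union, not_or]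
    refine (and_iff_right hu).trans ⟨fun h w => ?_, fun h => by simpa [callTargets] using h u⟩
    by_cases hw : w = u
    · subst hw; simpa [callTargets] using h
    · simp [callTargets, hw]
  | pp =>
    rw [nextInformed, Finset.mem_union, not_or, Finset.mem_union, not_or, hpush]
    refine ⟨fun ⟨⟨_, hpushed⟩, hpulled⟩ w => ?_, fun h => ⟨⟨hu, fun w hw => ?_⟩, ?_⟩⟩
    · by_cases hw : w = u
      · subst hw; simpa [callTargets] using hpulled
      · by_cases hwI : w ∈ I
        · simpa [callTargets, hw, hwI] using hpushed w hwI
        · simp [callTargets, hw, hwI]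
    · have hne : w ≠ u := fun e => hu (e ▸ hw)
      simpa [callTargets, hne, hw] using h w
    · simpa [callTargets] using h u

theorem card_compl_eq_sum_indicator {I J : Finset V} (h : I ⊆ J) :
    (Jᶜ.card : ℝ) = (∑ u ∈ Iᶜ, Set.indicator {J : Finset V | u ∉ J} (1 : Finset V → ℝ)) J := by
  simp only [Finset.sum_apply, Set.indicator_apply, Set.mem_ofPred_eq, Pi.one_apply,
    Finset.sum_boole]
  congr 2
  ext x
  simpa using mt (@h x)

end Combinatorics

section RoundLaw

variable {V : Type*} [Fintype V] [DecidableEq V] (G : SimpleGraph V) [DecidableRel G.Adj]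

/-- The probability that an uninformed vertex `u` stays uninformed in one round. -/
noncomputable def stayProb (P : Protocol) (q : ℝ) (I : Finset V) (u : V) : ℝ :=
  (1 - pullRate P q * degreeIn G I u / G.degree u) *
    ∏ w ∈ G.neighborFinset u ∩ I, (1 - pushRate P q / G.degree w)

theorem prod_one_sub_degreeIn_singleton (q : ℝ) (I : Finset V) (u : V) :
    ∏ w, (1 - q * degreeIn G (if w ∈ I then {u} else ∅) w / G.degree w) =
      ∏ w ∈ G.neighborFinset u ∩ I, (1 - q / G.degree w) := by
  rw [← Finset.prod_subset (Finset.subset_univ (G.neighborFinset u ∩ I))]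
  · refine Finset.prod_congr rfl fun w hw => ?_
    rw [Finset.mem_inter, SimpleGraph.mem_neighborFinset] at hw
    rw [if_pos hw.2, degreeIn_singleton, if_pos hw.1.symm, mul_one]
  · intro w _ hw
    rw [Finset.mem_inter, SimpleGraph.mem_neighborFinset, not_and'] at hw
    by_cases hwI : w ∈ I
    · rw [if_pos hwI, degreeIn_singleton, if_neg (fun h => hw hwI h.symm), mul_zero, zero_div,
        sub_zero]
    · rw [if_neg hwI, degreeIn_empty, mul_zero, zero_div, sub_zero]

theorem prod_one_sub_degreeIn_callTargets (P : Protocol) (q : ℝ) {I : Finset V} {u : V}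
    (hu : u ∉ I) :
    ∏ w, (1 - q * degreeIn G (callTargets P I w u) w / G.degree w) = stayProb G P q I u := by
  cases P with
  | push =>
    simpa [stayProb, pullRate, pushRate, callTargets] using
      prod_one_sub_degreeIn_singleton G q I u
  | pull =>
    simp only [stayProb, pullRate, pushRate, callTargets]
    rw [Finset.prod_eq_single u (fun w _ hw => by simp [hw, degreeIn_empty]) (by simp)]
    simp
  | pp =>
    simp only [stayProb, pullRate, pushRate, callTargets]
    rw [← prod_one_sub_degreeIn_singleton, ← Finset.mul_prod_erase _ _ (Finset.mem_univ u),
      ← Finset.mul_prod_erase (a := u) _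
        (fun w => 1 - q * degreeIn G (if w ∈ I then {u} else ∅) w / G.degree w)
        (Finset.mem_univ u)]
    simp only [if_true, hu, if_false, degreeIn_empty, mul_zero, zero_div, sub_zero, one_mul]
    congr 1
    refine Finset.prod_congr rfl fun w hw => ?_
    rw [if_neg (Finset.ne_of_mem_erase hw)]

theorem prod_one_sub_degreeIn_callTargets_union_le (P : Protocol) {q : ℝ}
    (hq : q ∈ Set.Icc (0 : ℝ) 1) {I : Finset V} {u v : V} (huv : u ≠ v) (hu : u ∉ I) (hv : v ∉ I) :
    ∏ w, (1 - q * degreeIn G (callTargets P I w u ∪ callTargets P I w v) w / G.degree w) ≤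
      stayProb G P q I u * stayProb G P q I v := by
  rw [← prod_one_sub_degreeIn_callTargets G P q hu, ← prod_one_sub_degreeIn_callTargets G P q hv,
    ← Finset.prod_mul_distrib]
  refine Finset.prod_le_prod (fun w _ => sub_nonneg.2 (div_le_one_of_le₀ ?_ (Nat.cast_nonneg _)))
    fun w _ => ?_
  · exact (mul_le_of_le_one_left (degreeIn_nonneg G _ w) hq.2).trans (degreeIn_le_degree G _ w)
  · rw [degreeIn_union_of_disjoint G (disjoint_callTargets P huv hu hv w), mul_add, add_div]
    have hnonneg (S : Finset V) : 0 ≤ q * degreeIn G S w / G.degree w :=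
      div_nonneg (mul_nonneg hq.1 (degreeIn_nonneg G S w)) (Nat.cast_nonneg _)
    nlinarith [mul_nonneg (hnonneg (callTargets P I w u)) (hnonneg (callTargets P I w v))]

variable [MeasurableSpace V] [MeasurableSingletonClass V]

theorem neighbourLaw_real {w : V} (hw : 0 < G.degree w) (S : Finset V) :
    (neighbourLaw G w).toMeasure.real (S : Set V) = degreeIn G S w / G.degree w := by
  have hne : (G.neighborFinset w).Nonempty := by
    rwa [← Finset.card_pos, SimpleGraph.card_neighborFinset_eq_degree]
  rw [neighbourLaw, dif_pos hne, measureReal_def,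
    PMF.toMeasure_uniformOfFinset_apply _ _ S.measurableSet, ENNReal.toReal_div]
  simp only [ENNReal.toReal_natCast, SimpleGraph.card_neighborFinset_eq_degree, degreeIn]
  congr 3
  ext x
  simp

theorem callLaw_real (q : unitInterval) {w : V} (hw : 0 < G.degree w) (S : Finset V) :
    ((neighbourLaw G w).toMeasure.prod (bernoulliMeasure true false q)).real
      {x | ¬ (x.1 ∈ S ∧ x.2 = true)} = 1 - q * degreeIn G S w / G.degree w := by
  have hset : {x : V × Bool | ¬ (x.1 ∈ S ∧ x.2 = true)} = ((S : Set V) ×ˢ {true})ᶜ := by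
    ext x; simp
  rw [hset, probReal_compl_eq_one_sub (Set.toFinite _).measurableSet, measureReal_prod_prod,
    neighbourLaw_real G hw,
    bernoulliMeasure_real_apply_of_mem_of_notMem q (by simp) (by simp) (by simp)]
  ring

variable {G}

theorem roundLaw_real_forall_not (q : unitInterval) (hG : ∀ w, 0 < G.degree w)
    (S : V → Finset V) :
    (roundLaw G q).real {r | ∀ w, ¬ ((r w).1 ∈ S w ∧ (r w).2 = true)} =
      ∏ w, (1 - q * degreeIn G (S w) w / G.degree w) := by
  have hset : {r : Round V | ∀ w, ¬ ((r w).1 ∈ S w ∧ (r w).2 = true)} =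
      Set.univ.pi fun w => {x | ¬ (x.1 ∈ S w ∧ x.2 = true)} := by
    ext r; simp
  rw [hset, roundLaw, measureReal_def, Measure.pi_pi, ENNReal.toReal_prod]
  exact Finset.prod_congr rfl fun w _ => callLaw_real G q (hG w) (S w)

variable (P : Protocol) (q : unitInterval) {I : Finset V} {u v : V}

theorem roundLaw_real_notMem_nextInformed (hG : ∀ w, 0 < G.degree w) (hu : u ∉ I) :
    (roundLaw G q).real {r | u ∉ nextInformed P I r} = stayProb G P q I u := by
  simp_rw [notMem_nextInformed_iff P hu]
  rw [roundLaw_real_forall_not q hG, prod_one_sub_degreeIn_callTargets G P q hu]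

theorem roundLaw_real_notMem_and_notMem_nextInformed_le (hG : ∀ w, 0 < G.degree w) (huv : u ≠ v)
    (hu : u ∉ I) (hv : v ∉ I) :
    (roundLaw G q).real {r | u ∉ nextInformed P I r ∧ v ∉ nextInformed P I r} ≤
      stayProb G P q I u * stayProb G P q I v := by
  have hset : {r | u ∉ nextInformed P I r ∧ v ∉ nextInformed P I r} =
      {r : Round V | ∀ w, ¬ ((r w).1 ∈ callTargets P I w u ∪ callTargets P I w v ∧
        (r w).2 = true)} := by
    ext r
    simp only [Set.mem_ofPred_eq, notMem_nextInformed_iff P hu, notMem_nextInformed_iff P hv,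
      ← forall_and, Finset.mem_union, or_and_right, not_or]
  rw [hset, roundLaw_real_forall_not q hG]
  exact prod_one_sub_degreeIn_callTargets_union_le G P q.2 huv hu hv

theorem stayProb_mem_Icc (hG : ∀ w, 0 < G.degree w) (hu : u ∉ I) :
    stayProb G P q I u ∈ Set.Icc (0 : ℝ) 1 := by
  rw [← roundLaw_real_notMem_nextInformed P q hG hu]
  exact ⟨measureReal_nonneg, measureReal_le_one⟩

end RoundLaw

section Transition

variable {V : Type*} [Fintype V] [DecidableEq V] [MeasurableSpace V] [MeasurableSingletonClass V]
  (G : SimpleGraph V) [DecidableRel G.Adj] (P : Protocol) (q : unitInterval)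

/-- The transition operator of the Markov chain of informed sets: it maps `F` to the expectation
of `F` at the informed set after one round, as a function of the initial informed set. The expected
values after `t` rounds are given by its powers. -/
noncomputable def transition : Module.End ℝ (Finset V → ℝ) where
  toFun F I := ∫ r, F (nextInformed P I r) ∂roundLaw G q
  map_add' _ _ := funext fun _ => integral_add Integrable.of_finite Integrable.of_finite
  map_smul' c _ := funext fun _ => integral_const_mul c _

/-- The expected number of uninformed vertices after one round started from `I`, see
`transition_card_compl`. -/
noncomputable def meanUninformed (I : Finset V) : ℝ := ∑ u ∈ Iᶜ, stayProb G P q I u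

variable {G P q} {F F' : Finset V → ℝ} {I : Finset V}

theorem transition_apply : transition G P q F I = ∫ r, F (nextInformed P I r) ∂roundLaw G q := rfl

theorem transition_mono (h : ∀ J, I ⊆ J → F J ≤ F' J) :
    transition G P q F I ≤ transition G P q F' I :=
  integral_mono Integrable.of_finite Integrable.of_finite fun r => h _ (subset_nextInformed P I r)

theorem transition_congr (h : ∀ J, I ⊆ J → F J = F' J) :
    transition G P q F I = transition G P q F' I :=
  (transition_mono fun J hJ => (h J hJ).le).antisymm (transition_mono fun J hJ => (h J hJ).ge)

theorem transition_const (c : ℝ) :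
    transition G P q (Function.const _ c) = Function.const _ c := by
  ext I
  simp [transition_apply]

theorem transition_indicator (A : Set (Finset V)) :
    transition G P q (A.indicator 1) I = (roundLaw G q).real {r | nextInformed P I r ∈ A} := by
  rw [← integral_indicator_one (Set.toFinite _).measurableSet]
  rfl

theorem transition_card_compl (hG : ∀ w, 0 < G.degree w) :
    transition G P q (fun J => (Jᶜ.card : ℝ)) I = meanUninformed G P q I := by
  rw [transition_congr fun J hJ => card_compl_eq_sum_indicator hJ, map_sum, Finset.sum_apply]
  refine Finset.sum_congr rfl fun u hu => ?_
  rw [transition_indicator]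
  exact roundLaw_real_notMem_nextInformed P q hG (Finset.mem_compl.1 hu)

theorem sum_transition_notMem_and_notMem_le (hG : ∀ w, 0 < G.degree w) {u : V} (hu : u ∈ Iᶜ) :
    ∑ v ∈ Iᶜ, transition G P q (Set.indicator {J | u ∉ J ∧ v ∉ J} 1) I ≤
      stayProb G P q I u * meanUninformed G P q I +
        stayProb G P q I u * (1 - stayProb G P q I u) := by
  have hself : transition G P q (Set.indicator {J | u ∉ J ∧ u ∉ J} 1) I =
      stayProb G P q I u := by
    rw [← roundLaw_real_notMem_nextInformed P q hG (Finset.mem_compl.1 hu), transition_indicator]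
    simp
  have hothers : ∑ v ∈ Iᶜ.erase u, transition G P q (Set.indicator {J | u ∉ J ∧ v ∉ J} 1) I ≤
      ∑ v ∈ Iᶜ.erase u, stayProb G P q I u * stayProb G P q I v := by
    refine Finset.sum_le_sum fun v hv => ?_
    rw [transition_indicator]
    exact roundLaw_real_notMem_and_notMem_nextInformed_le P q hG (Finset.ne_of_mem_erase hv).symm
      (Finset.mem_compl.1 hu) (Finset.mem_compl.1 (Finset.mem_of_mem_erase hv))
  rw [meanUninformed, Finset.mul_sum, ← Finset.add_sum_erase _ _ hu, hself,
    ← Finset.add_sum_erase (a := u) _ (fun v => stayProb G P q I u * stayProb G P q I v) hu]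
  linarith

theorem transition_card_compl_sq_le (hG : ∀ w, 0 < G.degree w) :
    transition G P q (fun J => (Jᶜ.card : ℝ) ^ 2) I ≤ meanUninformed G P q I ^ 2 +
      ∑ u ∈ Iᶜ, stayProb G P q I u * (1 - stayProb G P q I u) := by
  have hsq : ∀ J, I ⊆ J → (Jᶜ.card : ℝ) ^ 2 =
      (∑ u ∈ Iᶜ, ∑ v ∈ Iᶜ, Set.indicator {J : Finset V | u ∉ J ∧ v ∉ J}
        (1 : Finset V → ℝ)) J := by
    intro J hJ
    simp only [card_compl_eq_sum_indicator hJ, sq, Finset.sum_apply, Finset.sum_mul_sum,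
      Set.indicator_apply, Set.mem_ofPred_eq, Pi.one_apply, ite_and, ite_mul, one_mul, zero_mul]
  rw [transition_congr hsq, map_sum, Finset.sum_apply, sq]
  nth_rw 1 [meanUninformed]
  rw [Finset.sum_mul, ← Finset.sum_add_distrib]
  refine Finset.sum_le_sum fun u hu => ?_
  rw [map_sum, Finset.sum_apply]
  exact sum_transition_notMem_and_notMem_le hG hu

theorem transition_sq_sub_meanUninformed_le (hG : ∀ w, 0 < G.degree w) :
    transition G P q (fun J => ((Jᶜ.card : ℝ) - meanUninformed G P q I) ^ 2) I ≤
      ∑ u ∈ Iᶜ, stayProb G P q I u * (1 - stayProb G P q I u) := by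
  set m := meanUninformed G P q I with hm
  have hexpand : (fun J : Finset V => ((Jᶜ.card : ℝ) - m) ^ 2) =
      (fun J => (Jᶜ.card : ℝ) ^ 2) - (2 * m) • (fun J => (Jᶜ.card : ℝ)) +
        Function.const _ (m ^ 2) := by
    ext J
    simp only [Pi.add_apply, Pi.sub_apply, Pi.smul_apply, smul_eq_mul, Function.const_apply]
    ring
  have hmean : transition G P q (fun J => ((Jᶜ.card : ℝ) - m) ^ 2) I =
      transition G P q (fun J => (Jᶜ.card : ℝ) ^ 2) I - m ^ 2 := by
    rw [hexpand, map_add, map_sub, map_smul, transition_const, Pi.add_apply, Pi.sub_apply,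
      Pi.smul_apply, transition_card_compl hG, ← hm, Function.const_apply, smul_eq_mul]
    ring
  rw [hmean]
  linarith [transition_card_compl_sq_le (P := P) (q := q) (I := I) hG]

end Transition

/-! ### Expected progress in one round -/

section StayProb

variable {V : Type*} [Fintype V] {G : SimpleGraph V} [DecidableRel G.Adj]

theorem prod_one_sub_div_degree_nonneg (hG : ∀ w, 0 < G.degree w) {a : ℝ} (ha : a ≤ 1)
    (S : Finset V) : 0 ≤ ∏ w ∈ S, (1 - a / G.degree w) := by
  refine Finset.prod_nonneg fun w _ => sub_nonneg.2 (div_le_one_of_le₀ ?_ (Nat.cast_nonneg _))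
  exact ha.trans (by exact_mod_cast hG w)

variable [DecidableEq V] {P : Protocol} {I : Finset V}

theorem prod_one_sub_div_degree_le_exp (hG : ∀ w, 0 < G.degree w) {a : ℝ}
    (ha : a ∈ Set.Icc (0 : ℝ) 1) (u : V) :
    ∏ w ∈ G.neighborFinset u ∩ I, (1 - a / G.degree w) ≤
      Real.exp (-(a * degreeIn G I u / G.maxDegree)) := by
  calc ∏ w ∈ G.neighborFinset u ∩ I, (1 - a / G.degree w)
      ≤ ∏ _w ∈ G.neighborFinset u ∩ I, Real.exp (-(a / G.maxDegree)) := by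
        refine Finset.prod_le_prod (fun w _ => ?_) fun w _ => ?_
        · simpa using prod_one_sub_div_degree_nonneg hG ha.2 {w}
        · refine le_trans ?_ (Real.one_sub_le_exp_neg _)
          have hdeg : (0 : ℝ) < G.degree w := Nat.cast_pos.2 (hG w)
          have ha0 := ha.1
          gcongr
          exact G.degree_le_maxDegree w
    _ = Real.exp (-(a * degreeIn G I u / G.maxDegree)) := by
        rw [Finset.prod_const, ← Real.exp_nat_mul, degreeIn]
        ring_nf

theorem stayProb_le_exp (hG : ∀ w, 0 < G.degree w) {q : ℝ} (hq : q ∈ Set.Icc (0 : ℝ) 1) (u : V) :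
    stayProb G P q I u ≤ Real.exp (-(growthRate P q * degreeIn G I u / G.maxDegree)) := by
  have hpull : 1 - pullRate P q * degreeIn G I u / G.degree u ≤
      Real.exp (-(pullRate P q * degreeIn G I u / G.maxDegree)) := by
    refine le_trans ?_ (Real.one_sub_le_exp_neg _)
    have hnum := mul_nonneg (pullRate_mem_Icc P hq).1 (degreeIn_nonneg G I u)
    have hdeg : (0 : ℝ) < G.degree u := Nat.cast_pos.2 (hG u)
    gcongr
    exact G.degree_le_maxDegree u
  refine (mul_le_mul hpull (prod_one_sub_div_degree_le_exp hG (pushRate_mem_Icc P hq) u)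
    (prod_one_sub_div_degree_nonneg hG (pushRate_mem_Icc P hq).2 _)
    (Real.exp_pos _).le).trans_eq ?_
  rw [← Real.exp_add, growthRate]
  ring_nf

theorem pullRate_mul_degreeIn_div_degree_mem_Icc {q : ℝ} (hq : q ∈ Set.Icc (0 : ℝ) 1) (u : V) :
    pullRate P q * degreeIn G I u / G.degree u ∈ Set.Icc (0 : ℝ) 1 := by
  have hrate := pullRate_mem_Icc P hq
  refine ⟨div_nonneg (mul_nonneg hrate.1 (degreeIn_nonneg G I u)) (Nat.cast_nonneg _),
    div_le_one_of_le₀ ?_ (Nat.cast_nonneg _)⟩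
  exact (mul_le_of_le_one_left (degreeIn_nonneg G I u) hrate.2).trans (degreeIn_le_degree G I u)

theorem sum_div_degree_le (hδ : 0 < G.minDegree) {a : ℝ} (ha : 0 ≤ a) (u : V) :
    ∑ w ∈ G.neighborFinset u ∩ I, a / G.degree w ≤ a * degreeIn G I u / G.minDegree := by
  calc ∑ w ∈ G.neighborFinset u ∩ I, a / G.degree w
      ≤ ∑ _w ∈ G.neighborFinset u ∩ I, a / (G.minDegree : ℝ) := by
        refine Finset.sum_le_sum fun w _ => ?_
        gcongr
        exact G.minDegree_le_degree w
    _ = a * degreeIn G I u / G.minDegree := by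
        rw [Finset.sum_const, nsmul_eq_mul, degreeIn]
        ring

theorem one_sub_stayProb_le (hδ : 0 < G.minDegree) {q : ℝ} (hq : q ∈ Set.Icc (0 : ℝ) 1) (u : V) :
    1 - stayProb G P q I u ≤ growthRate P q * degreeIn G I u / G.minDegree := by
  have hdeg (w : V) : 1 ≤ (G.degree w : ℝ) := by
    exact_mod_cast hδ.trans_le (G.minDegree_le_degree w)
  have hpush := pushRate_mem_Icc P hq
  have hprod := one_sub_sum_le_prod_one_sub (G.neighborFinset u ∩ I)
    (fun w => pushRate P q / G.degree w) fun w _ =>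
      ⟨div_nonneg hpush.1 (Nat.cast_nonneg _),
        div_le_one_of_le₀ (hpush.2.trans (hdeg w)) (Nat.cast_nonneg _)⟩
  have hsum := sum_div_degree_le (I := I) hδ hpush.1 u
  have hsum0 : 0 ≤ ∑ w ∈ G.neighborFinset u ∩ I, pushRate P q / G.degree w :=
    Finset.sum_nonneg fun w _ => div_nonneg hpush.1 (Nat.cast_nonneg _)
  have hpull := pullRate_mul_degreeIn_div_degree_mem_Icc (G := G) (P := P) (I := I) hq u
  have hpull_le : pullRate P q * degreeIn G I u / G.degree u ≤
      pullRate P q * degreeIn G I u / G.minDegree := by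
    have hnum := mul_nonneg (pullRate_mem_Icc P hq).1 (degreeIn_nonneg G I u)
    gcongr
    exact G.minDegree_le_degree u
  rw [growthRate, add_mul, add_div, stayProb]
  nlinarith [mul_le_mul_of_nonneg_left hprod (sub_nonneg.2 hpull.2), mul_nonneg hpull.1 hsum0]

end StayProb

section Estimates

variable {V : Type*} [Fintype V] [DecidableEq V] {G : SimpleGraph V} [DecidableRel G.Adj]
  {η : ℝ} {P : Protocol} {I : Finset V}

theorem IsQuasirandom.degree_pos (h : IsQuasirandom G η) (w : V) : 0 < G.degree w :=
  h.minDegree_pos.trans_le (G.minDegree_le_degree w)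

theorem IsQuasirandom.minDegree_cast_pos (h : IsQuasirandom G η) : (0 : ℝ) < G.minDegree :=
  Nat.cast_pos.2 h.minDegree_pos

theorem IsQuasirandom.maxDegree_cast_pos (h : IsQuasirandom G η) : (0 : ℝ) < G.maxDegree :=
  h.minDegree_cast_pos.trans_le (Nat.cast_le.2 G.minDegree_le_maxDegree)

theorem IsQuasirandom.eta_pos (h : IsQuasirandom G η) : 0 < η :=
  pos_of_mul_pos_left (one_pos.trans_le h.one_le) h.minDegree_cast_pos.le

theorem IsQuasirandom.one_sub_le_minDegree_div_maxDegree (h : IsQuasirandom G η) :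
    1 - η ≤ G.minDegree / G.maxDegree := by
  rw [le_div_iff₀ h.maxDegree_cast_pos]
  have hle : (G.minDegree : ℝ) ≤ G.maxDegree := Nat.cast_le.2 G.minDegree_le_maxDegree
  nlinarith [h.maxDegree_le, h.eta_pos]

theorem IsQuasirandom.half_le_minDegree_div_maxDegree (h : IsQuasirandom G η) (hη : η ≤ 1) :
    1 / 2 ≤ (G.minDegree : ℝ) / G.maxDegree := by
  rw [le_div_iff₀ h.maxDegree_cast_pos]
  nlinarith [h.maxDegree_le, h.minDegree_cast_pos]

theorem IsQuasirandom.card_div_add_le (h : IsQuasirandom G η) {S : Finset V}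
    (hS : (S.card : ℝ) ≤ η * Fintype.card V) : S.card / Fintype.card V + η ≤ 2 * η := by
  linarith [div_le_of_le_mul₀ (Nat.cast_nonneg _) h.eta_pos.le hS]

theorem IsQuasirandom.sum_degreeIn_self_le (h : IsQuasirandom G η) {S : Finset V} {x : ℝ}
    (hx : S.card / Fintype.card V + η ≤ x) :
    ∑ u ∈ S, degreeIn G S u ≤ G.minDegree * S.card * √x := by
  have hx0 : 0 ≤ x := (add_nonneg (by positivity) h.eta_pos.le).trans hx
  refine le_of_abs_le (abs_le_of_sq_le_sq ?_ (by positivity))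
  have hsq : ∑ u ∈ S, degreeIn G S u ^ 2 ≤ ∑ u, degreeIn G S u ^ 2 :=
    Finset.sum_le_sum_of_subset_of_nonneg (Finset.subset_univ _) fun _ _ _ => sq_nonneg _
  calc (∑ u ∈ S, degreeIn G S u) ^ 2
      ≤ S.card * ∑ u ∈ S, degreeIn G S u ^ 2 := sq_sum_le_card_mul_sum_sq
    _ ≤ S.card * ((G.minDegree : ℝ) ^ 2 * (S.card * (S.card / Fintype.card V + η))) := by
        gcongr
        exact hsq.trans (h.mixing S)
    _ = (G.minDegree * S.card) ^ 2 * (S.card / Fintype.card V + η) := by ring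
    _ ≤ (G.minDegree * S.card) ^ 2 * x := by gcongr
    _ = (G.minDegree * S.card * √x) ^ 2 := by rw [mul_pow _ (√x), Real.sq_sqrt hx0]

theorem IsQuasirandom.le_sum_degreeIn_compl (h : IsQuasirandom G η) {S : Finset V} {x : ℝ}
    (hx : S.card / Fintype.card V + η ≤ x) :
    G.minDegree * S.card * (1 - √x) ≤ ∑ u ∈ S, degreeIn G Sᶜ u := by
  have hsplit : ∑ u ∈ S, degreeIn G S u + ∑ u ∈ S, degreeIn G Sᶜ u = ∑ u ∈ S, (G.degree u : ℝ) := by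
    rw [← Finset.sum_add_distrib]
    exact Finset.sum_congr rfl fun u _ => degreeIn_add_degreeIn_compl G S u
  nlinarith [h.sum_degreeIn_self_le hx, minDegree_mul_card_le_sum_degree G S]

section Growth

variable {q : unitInterval}

theorem card_compl_sub_meanUninformed :
    (Iᶜ.card : ℝ) - meanUninformed G P q I = ∑ u ∈ Iᶜ, (1 - stayProb G P q I u) := by
  simp [meanUninformed, Finset.sum_sub_distrib]

theorem IsQuasirandom.card_compl_sub_meanUninformed_le (h : IsQuasirandom G η) :
    (Iᶜ.card : ℝ) - meanUninformed G P q I ≤ growthRate P q * (1 + η) * I.card := by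
  have hrate := growthRate_nonneg P q.2
  have hδ := h.minDegree_cast_pos
  rw [card_compl_sub_meanUninformed]
  calc ∑ u ∈ Iᶜ, (1 - stayProb G P q I u)
      ≤ ∑ u ∈ Iᶜ, growthRate P q * degreeIn G I u / G.minDegree :=
        Finset.sum_le_sum fun u _ => one_sub_stayProb_le h.minDegree_pos q.2 u
    _ ≤ ∑ u, growthRate P q * degreeIn G I u / G.minDegree :=
        Finset.sum_le_sum_of_subset_of_nonneg (Finset.subset_univ _) fun u _ _ =>
          div_nonneg (mul_nonneg hrate (degreeIn_nonneg G I u)) hδ.le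
    _ = growthRate P q / G.minDegree * ∑ w ∈ I, (G.degree w : ℝ) := by
        simp_rw [← degreeIn_univ G, ← sum_degreeIn_comm, Finset.mul_sum, mul_div_right_comm]
    _ ≤ growthRate P q / G.minDegree * (((1 + η) * G.minDegree) * I.card) := by
        gcongr
        exact (sum_degree_le_maxDegree_mul_card G I).trans (by gcongr; exact h.maxDegree_le)
    _ = growthRate P q * (1 + η) * I.card := by field_simp

theorem sub_sq_le_one_sub_stayProb (hG : ∀ w, 0 < G.degree w) (u : V) :
    growthRate P q / G.maxDegree * degreeIn G I u -
      (growthRate P q / G.maxDegree) ^ 2 / 2 * degreeIn G I u ^ 2 ≤ 1 - stayProb G P q I u := by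
  have hexp := exp_neg_le_one_sub_add_sq_div_two
    (x := growthRate P q * degreeIn G I u / G.maxDegree)
    (div_nonneg (mul_nonneg (growthRate_nonneg P q.2) (degreeIn_nonneg G I u))
      (Nat.cast_nonneg _))
  have hstay := stayProb_le_exp (P := P) (I := I) hG q.2 u
  rw [mul_div_right_comm] at hexp hstay
  rw [mul_pow] at hexp
  linarith

theorem IsQuasirandom.le_mul_sum_degreeIn (h : IsQuasirandom G η) (hη : η ≤ 1 / 2)
    (hI : (I.card : ℝ) ≤ η * Fintype.card V) :
    growthRate P q * I.card * (1 - √(2 * η) - η) ≤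
      growthRate P q / G.maxDegree * ∑ u ∈ Iᶜ, degreeIn G I u := by
  have hη0 := h.eta_pos
  have hc := growthRate_nonneg P q.2
  have hsqrt : 0 ≤ 1 - √(2 * η) := sub_nonneg.2 (Real.sqrt_le_one.2 (by linarith))
  set c : ℝ := growthRate P q
  set D : ℝ := (G.maxDegree : ℝ)
  set d : ℝ := (G.minDegree : ℝ)
  set k : ℝ := (I.card : ℝ)
  rw [sum_degreeIn_comm]
  calc c * k * (1 - √(2 * η) - η) ≤ c * k * ((1 - η) * (1 - √(2 * η))) := by
        have : 0 ≤ η * √(2 * η) := by positivity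
        gcongr
        linarith
    _ ≤ c * k * (d / D * (1 - √(2 * η))) := by
        gcongr
        exact h.one_sub_le_minDegree_div_maxDegree
    _ = c / D * (d * k * (1 - √(2 * η))) := by ring
    _ ≤ c / D * ∑ u ∈ I, degreeIn G Iᶜ u := by
        gcongr
        exact h.le_sum_degreeIn_compl (h.card_div_add_le hI)

theorem IsQuasirandom.mul_sum_degreeIn_sq_le (h : IsQuasirandom G η)
    (hI : (I.card : ℝ) ≤ η * Fintype.card V) :
    (growthRate P q / G.maxDegree) ^ 2 / 2 * ∑ u ∈ Iᶜ, degreeIn G I u ^ 2 ≤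
      2 * growthRate P q * I.card * η := by
  have hη0 := h.eta_pos
  have hc := growthRate_nonneg P q.2
  have hc2 := growthRate_le_two P q.2
  have hdD : (G.minDegree : ℝ) / G.maxDegree ≤ 1 :=
    div_le_one_of_le₀ (Nat.cast_le.2 G.minDegree_le_maxDegree) (Nat.cast_nonneg _)
  set c : ℝ := growthRate P q
  set D : ℝ := (G.maxDegree : ℝ)
  set d : ℝ := (G.minDegree : ℝ)
  set k : ℝ := (I.card : ℝ)
  calc (c / D) ^ 2 / 2 * ∑ u ∈ Iᶜ, degreeIn G I u ^ 2
      ≤ (c / D) ^ 2 / 2 * (d ^ 2 * (k * (2 * η))) := by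
        gcongr
        refine (Finset.sum_le_sum_of_subset_of_nonneg (Finset.subset_univ _)
          fun _ _ _ => sq_nonneg _).trans ((h.mixing I).trans ?_)
        gcongr
        exact h.card_div_add_le hI
    _ = c * c * (k * η) * (d / D) ^ 2 := by ring
    _ ≤ 2 * c * (k * η) * 1 ^ 2 := by gcongr
    _ = 2 * c * k * η := by ring

theorem IsQuasirandom.le_card_compl_sub_meanUninformed (h : IsQuasirandom G η) (hη : η ≤ 1 / 2)
    (hI : (I.card : ℝ) ≤ η * Fintype.card V) :
    growthRate P q * I.card * (1 - √(2 * η) - 3 * η) ≤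
      (Iᶜ.card : ℝ) - meanUninformed G P q I := by
  set c : ℝ := growthRate P q
  set D : ℝ := (G.maxDegree : ℝ)
  calc c * I.card * (1 - √(2 * η) - 3 * η)
      = c * I.card * (1 - √(2 * η) - η) - 2 * c * I.card * η := by ring
    _ ≤ c / D * ∑ u ∈ Iᶜ, degreeIn G I u - (c / D) ^ 2 / 2 * ∑ u ∈ Iᶜ, degreeIn G I u ^ 2 :=
        sub_le_sub (h.le_mul_sum_degreeIn hη hI) (h.mul_sum_degreeIn_sq_le hI)
    _ ≤ (Iᶜ.card : ℝ) - meanUninformed G P q I := by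
        rw [card_compl_sub_meanUninformed, Finset.mul_sum, Finset.mul_sum,
          ← Finset.sum_sub_distrib]
        exact Finset.sum_le_sum fun u _ => sub_sq_le_one_sub_stayProb h.degree_pos u

theorem mul_degreeIn_le_one_sub_stayProb (hG : ∀ w, 0 < G.degree w) (u : V) :
    growthRate P q / G.maxDegree / 3 * degreeIn G I u ≤ 1 - stayProb G P q I u := by
  have hc := growthRate_nonneg P q.2
  have hle_two : growthRate P q * degreeIn G I u / G.maxDegree ≤ 2 := by
    rw [mul_div_assoc]
    exact (mul_le_of_le_one_right hc
      (div_le_one_of_le₀ (degreeIn_le_maxDegree G I u) (Nat.cast_nonneg _))).trans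
      (growthRate_le_two P q.2)
  have hexp := div_three_le_one_sub_exp_neg
    (div_nonneg (mul_nonneg hc (degreeIn_nonneg G I u)) (Nat.cast_nonneg _)) hle_two
  calc growthRate P q / G.maxDegree / 3 * degreeIn G I u
      = growthRate P q * degreeIn G I u / G.maxDegree / 3 := by ring
    _ ≤ 1 - stayProb G P q I u := hexp.trans (sub_le_sub_left (stayProb_le_exp hG q.2 u) 1)

theorem IsQuasirandom.meanUninformed_le_of_dense (h : IsQuasirandom G η) {ε : ℝ} (hη1 : η ≤ 1)
    (hηε : η ≤ ε / 2) (hI : (Iᶜ.card : ℝ) ≤ (1 - ε) * Fintype.card V) :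
    meanUninformed G P q I ≤ (1 - growthRate P q / 6 * (1 - √(1 - ε / 2))) * Iᶜ.card := by
  have hη0 := h.eta_pos
  have hc := growthRate_nonneg P q.2
  have hD := h.maxDegree_cast_pos
  have hsqrt : 0 ≤ 1 - √(1 - ε / 2) := sub_nonneg.2 (Real.sqrt_le_one.2 (by linarith))
  rcases isEmpty_or_nonempty V with hV | hV
  · simp [meanUninformed, Finset.eq_empty_of_isEmpty Iᶜ]
  have hdensity : Iᶜ.card / Fintype.card V + η ≤ 1 - ε / 2 := by
    linarith [(div_le_iff₀ (Nat.cast_pos.2 (Fintype.card_pos (α := V)))).2 hI]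
  have hmain : growthRate P q / 6 * (1 - √(1 - ε / 2)) * Iᶜ.card ≤
      (Iᶜ.card : ℝ) - meanUninformed G P q I := by
    calc growthRate P q / 6 * (1 - √(1 - ε / 2)) * Iᶜ.card
        = growthRate P q / 3 * (1 / 2) * Iᶜ.card * (1 - √(1 - ε / 2)) := by ring
      _ ≤ growthRate P q / 3 * (G.minDegree / G.maxDegree) * Iᶜ.card * (1 - √(1 - ε / 2)) := by
          have hhalf := h.half_le_minDegree_div_maxDegree hη1
          gcongr
      _ = growthRate P q / G.maxDegree / 3 *
            (G.minDegree * Iᶜ.card * (1 - √(1 - ε / 2))) := by ring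
      _ ≤ growthRate P q / G.maxDegree / 3 * ∑ u ∈ Iᶜ, degreeIn G I u := by
          have hsum := h.le_sum_degreeIn_compl hdensity
          rw [compl_compl] at hsum
          gcongr
      _ ≤ (Iᶜ.card : ℝ) - meanUninformed G P q I := by
          rw [card_compl_sub_meanUninformed, Finset.mul_sum]
          exact Finset.sum_le_sum fun u _ => mul_degreeIn_le_one_sub_stayProb h.degree_pos u
  linarith

end Growth

section Shrink

theorem one_sub_mul_degreeIn_div_degree_le (hδ : 0 < G.minDegree) {b : ℝ} (hb : b ≤ 1) (u : V) :
    1 - b * degreeIn G I u / G.degree u ≤ 1 - b + degreeIn G Iᶜ u / G.minDegree := by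
  have hdeg : (0 : ℝ) < G.degree u := by exact_mod_cast hδ.trans_le (G.minDegree_le_degree u)
  have hcompl := degreeIn_nonneg G Iᶜ u
  have hsplit : b * degreeIn G I u / G.degree u = b - b * (degreeIn G Iᶜ u / G.degree u) := by
    rw [← sub_eq_iff_eq_add'.2 (degreeIn_add_degreeIn_compl G I u).symm]
    field_simp
    ring
  have hpull : b * (degreeIn G Iᶜ u / G.degree u) ≤ degreeIn G Iᶜ u / G.degree u :=
    mul_le_of_le_one_left (by positivity) hb
  have hdiv : degreeIn G Iᶜ u / G.degree u ≤ degreeIn G Iᶜ u / G.minDegree := by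
    gcongr
    exact G.minDegree_le_degree u
  linarith

theorem IsQuasirandom.one_sub_degreeIn_div_maxDegree_le (h : IsQuasirandom G η) (u : V) :
    1 - degreeIn G I u / G.maxDegree ≤ η + degreeIn G Iᶜ u / G.minDegree := by
  have hδ := h.minDegree_cast_pos
  have hcompl := degreeIn_nonneg G Iᶜ u
  have hdiv : degreeIn G Iᶜ u / G.maxDegree ≤ degreeIn G Iᶜ u / G.minDegree := by
    gcongr
    exact G.minDegree_le_maxDegree
  have hsum : (G.minDegree : ℝ) / G.maxDegree ≤
      (degreeIn G I u + degreeIn G Iᶜ u) / G.maxDegree := by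
    rw [degreeIn_add_degreeIn_compl]
    gcongr
    exact G.minDegree_le_degree u
  rw [add_div] at hsum
  linarith [h.one_sub_le_minDegree_div_maxDegree]

theorem IsQuasirandom.exp_neg_mul_degreeIn_le (h : IsQuasirandom G η) {a : ℝ}
    (ha : a ∈ Set.Icc (0 : ℝ) 1) (u : V) :
    Real.exp (-(a * degreeIn G I u / G.maxDegree)) ≤
      Real.exp (-a) + (η + degreeIn G Iᶜ u / G.minDegree) := by
  have hfrac : degreeIn G I u / G.maxDegree ≤ 1 :=
    div_le_one_of_le₀ (degreeIn_le_maxDegree G I u) (Nat.cast_nonneg _)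
  have hfrac0 : 0 ≤ degreeIn G I u / G.maxDegree :=
    div_nonneg (degreeIn_nonneg G I u) (Nat.cast_nonneg _)
  rw [mul_div_assoc]
  have hexp := exp_neg_le_exp_neg_add_sub (mul_nonneg ha.1 hfrac0)
    (mul_le_of_le_one_right ha.1 hfrac)
  nlinarith [h.one_sub_degreeIn_div_maxDegree_le (I := I) u, ha.2]

variable {q : unitInterval}

theorem IsQuasirandom.stayProb_le_shrinkRate_add (h : IsQuasirandom G η) (u : V) :
    stayProb G P q I u ≤ shrinkRate P q + η + 2 / G.minDegree * degreeIn G Iᶜ u := by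
  have hpush := pushRate_mem_Icc P q.2
  have hfrac := pullRate_mul_degreeIn_div_degree_mem_Icc (G := G) (P := P) (I := I) q.2 u
  have hpull_le := one_sub_mul_degreeIn_div_degree_le (I := I) h.minDegree_pos
    (pullRate_mem_Icc P q.2).2 u
  have hpush_le := (prod_one_sub_div_degree_le_exp h.degree_pos hpush u).trans
    (h.exp_neg_mul_degreeIn_le (I := I) hpush u)
  have hexp : Real.exp (-pushRate P q) ≤ 1 := Real.exp_le_one_iff.2 (neg_nonpos.2 hpush.1)
  rw [stayProb, shrinkRate]
  set x := pullRate P q * degreeIn G I u / G.degree u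
  set y := degreeIn G Iᶜ u / G.minDegree with hy
  have hy0 : 0 ≤ y := div_nonneg (degreeIn_nonneg G Iᶜ u) (Nat.cast_nonneg _)
  have hη0 := h.eta_pos
  calc (1 - x) * ∏ w ∈ G.neighborFinset u ∩ I, (1 - pushRate P q / G.degree w)
      ≤ (1 - x) * (Real.exp (-pushRate P q) + (η + y)) :=
        mul_le_mul_of_nonneg_left hpush_le (sub_nonneg.2 hfrac.2)
    _ = (1 - x) * Real.exp (-pushRate P q) + (1 - x) * (η + y) := by ring
    _ ≤ (1 - pullRate P q + y) * Real.exp (-pushRate P q) + 1 * (η + y) := by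
        gcongr
        exact sub_le_self 1 hfrac.1
    _ ≤ (1 - pullRate P q) * Real.exp (-pushRate P q) + η + 2 * y := by nlinarith
    _ = (1 - pullRate P q) * Real.exp (-pushRate P q) + η +
          2 / G.minDegree * degreeIn G Iᶜ u := by rw [hy]; ring

theorem IsQuasirandom.meanUninformed_le_of_card_compl_le (h : IsQuasirandom G η)
    (hI : (Iᶜ.card : ℝ) ≤ η * Fintype.card V) :
    meanUninformed G P q I ≤ (shrinkRate P q + η + 2 * √(2 * η)) * Iᶜ.card := by
  have hδ := h.minDegree_cast_pos
  calc meanUninformed G P q I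
      ≤ ∑ u ∈ Iᶜ, (shrinkRate P q + η + 2 / G.minDegree * degreeIn G Iᶜ u) :=
        Finset.sum_le_sum fun u _ => h.stayProb_le_shrinkRate_add u
    _ = (shrinkRate P q + η) * Iᶜ.card +
          2 / G.minDegree * ∑ u ∈ Iᶜ, degreeIn G Iᶜ u := by
        rw [Finset.sum_add_distrib, Finset.sum_const, nsmul_eq_mul, ← Finset.mul_sum]
        ring
    _ ≤ (shrinkRate P q + η) * Iᶜ.card +
          2 / G.minDegree * (G.minDegree * Iᶜ.card * √(2 * η)) := by
        gcongr
        exact h.sum_degreeIn_self_le (h.card_div_add_le hI)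
    _ = (shrinkRate P q + η + 2 * √(2 * η)) * Iᶜ.card := by field_simp

theorem IsQuasirandom.exp_neg_le_one_sub_div_degree (h : IsQuasirandom G η) (hη : η < 1) {a : ℝ}
    (ha : a ∈ Set.Icc (0 : ℝ) 1) (w : V) :
    Real.exp (-(a / G.minDegree / (1 - η))) ≤ 1 - a / G.degree w := by
  have hδ := h.minDegree_cast_pos
  have ha0 := ha.1
  have hle : a / G.degree w ≤ a / G.minDegree := by
    gcongr
    exact G.minDegree_le_degree w
  have hle_eta : a / G.minDegree ≤ η := (div_le_iff₀ hδ).2 (ha.2.trans h.one_le)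
  refine le_trans (Real.exp_le_exp.2 (neg_le_neg ?_))
    (exp_neg_div_one_sub_le_one_sub (x := a / G.degree w) (by linarith))
  have : 0 < 1 - η := sub_pos.2 hη
  gcongr
  linarith

theorem IsQuasirandom.exp_neg_le_prod_one_sub_div_degree (h : IsQuasirandom G η) (hη : η < 1)
    {a : ℝ} (ha : a ∈ Set.Icc (0 : ℝ) 1) (u : V) :
    Real.exp (-(a * ((1 + η) / (1 - η)))) ≤
      ∏ w ∈ G.neighborFinset u ∩ I, (1 - a / G.degree w) := by
  have hδ := h.minDegree_cast_pos
  have ha0 := ha.1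
  have : 0 < 1 - η := sub_pos.2 hη
  calc Real.exp (-(a * ((1 + η) / (1 - η))))
      = Real.exp (-((1 + η) * G.minDegree * (a / G.minDegree / (1 - η)))) := by
        congr 2
        field_simp
    _ ≤ Real.exp (-(degreeIn G I u * (a / G.minDegree / (1 - η)))) := by
        gcongr
        exact (degreeIn_le_maxDegree G I u).trans h.maxDegree_le
    _ = ∏ _w ∈ G.neighborFinset u ∩ I, Real.exp (-(a / G.minDegree / (1 - η))) := by
        rw [Finset.prod_const, ← Real.exp_nat_mul, mul_neg, degreeIn]
    _ ≤ ∏ w ∈ G.neighborFinset u ∩ I, (1 - a / G.degree w) :=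
        Finset.prod_le_prod (fun w _ => (Real.exp_pos _).le)
          fun w _ => h.exp_neg_le_one_sub_div_degree hη ha w

theorem IsQuasirandom.le_stayProb (h : IsQuasirandom G η) (hη : η < 1) (u : V) :
    (1 - pullRate P q) * Real.exp (-(pushRate P q * ((1 + η) / (1 - η)))) ≤
      stayProb G P q I u := by
  have hpull := pullRate_mem_Icc P q.2
  have hle : pullRate P q * degreeIn G I u / G.degree u ≤ pullRate P q := by
    rw [mul_div_assoc]
    exact mul_le_of_le_one_right hpull.1
      (div_le_one_of_le₀ (degreeIn_le_degree G I u) (Nat.cast_nonneg _))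
  exact mul_le_mul (sub_le_sub_left hle 1)
    (h.exp_neg_le_prod_one_sub_div_degree hη (pushRate_mem_Icc P q.2) u)
    (Real.exp_pos _).le (sub_nonneg.2 (hle.trans hpull.2))

end Shrink

end Estimates

/-! ### Several rounds -/

section ProcessLaw

variable {V : Type*} [Fintype V] [MeasurableSpace V]

theorem processLaw_map_restrict_prodMk (G : SimpleGraph V) [DecidableRel G.Adj] (q : unitInterval)
    (t : ℕ) :
    (processLaw G q).map (fun ω => ((Finset.range t).restrict ω, ω t)) =
      ((processLaw G q).map (Finset.range t).restrict).prod (roundLaw G q) := by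
  have hindep : IndepFun (Finset.range t).restrict (fun ω => ω t) (processLaw G q) := by
    have h := (iIndepFun_infinitePi (P := fun _ : ℕ => roundLaw G q) (X := fun _ r => r)
      fun _ => measurable_id).indepFun_finset (Finset.range t) {t} (by simp) fun i => by fun_prop
    exact h.comp (φ := id) (ψ := fun x : ({t} : Finset ℕ) → Round V => x ⟨t, by simp⟩)
      measurable_id (measurable_pi_apply _)
  rw [hindep.map_prod_eq_prod_map_map (Finset.measurable_restrict _).aemeasurable
    (measurable_pi_apply t).aemeasurable]
  congr 1
  exact Measure.infinitePi_map_eval (fun _ : ℕ => roundLaw G q) t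

end ProcessLaw

section Chain

variable {V : Type*} [Fintype V] [DecidableEq V] {P : Protocol}

theorem informed_congr (P : Protocol) (v : V) {ω ω' : ℕ → Round V} {t : ℕ}
    (h : ∀ i < t, ω i = ω' i) : informed P v ω t = informed P v ω' t := by
  induction t with
  | zero => rfl
  | succ t ih =>
    rw [informed, informed, ih fun i hi => h i (hi.trans t.lt_succ_self), h t t.lt_succ_self]

theorem informed_mono (P : Protocol) (v : V) (ω : ℕ → Round V) : Monotone (informed P v ω) :=
  monotone_nat_of_le_succ fun _ => subset_nextInformed P _ _

/-- The informed set after `t` rounds as a function of the first `t` rounds only; this makes it a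
function on a finite type. -/
def informedOfRange (P : Protocol) (v : V) (t : ℕ) (x : Finset.range t → Round V) : Finset V :=
  informed P v (fun i => if h : i ∈ Finset.range t then x ⟨i, h⟩ else fun u => (u, true)) t

theorem informedOfRange_restrict (P : Protocol) (v : V) (t : ℕ) (ω : ℕ → Round V) :
    informedOfRange P v t ((Finset.range t).restrict ω) = informed P v ω t :=
  informed_congr P v fun i hi => by simp [hi]

variable [MeasurableSpace V] [MeasurableSingletonClass V]

theorem measurableSet_informed_mem (P : Protocol) (v : V) (t : ℕ) (A : Set (Finset V)) :
    MeasurableSet {ω : ℕ → Round V | informed P v ω t ∈ A} := by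
  have hpreimage : {ω : ℕ → Round V | informed P v ω t ∈ A} =
      (Finset.range t).restrict ⁻¹' (informedOfRange P v t ⁻¹' A) := by
    ext ω
    simp only [Set.mem_preimage, informedOfRange_restrict, Set.mem_ofPred_eq]
  rw [hpreimage]
  exact Finset.measurable_restrict (X := fun _ : ℕ => Round V) (Finset.range t)
    (Set.toFinite (informedOfRange P v t ⁻¹' A)).measurableSet

variable {G : SimpleGraph V} [DecidableRel G.Adj] {q : unitInterval} {F F' : Finset V → ℝ}
  {I : Finset V}

theorem integral_informed_succ (v : V) (t : ℕ) (F : Finset V → ℝ) :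
    ∫ ω, F (informed P v ω (t + 1)) ∂processLaw G q =
      ∫ ω, transition G P q F (informed P v ω t) ∂processLaw G q := by
  have hrestrict : Measurable ((Finset.range t).restrict (π := fun _ : ℕ => Round V)) :=
    Finset.measurable_restrict _
  have : IsProbabilityMeasure ((processLaw G q).map (Finset.range t).restrict) :=
    Measure.isProbabilityMeasure_map hrestrict.aemeasurable
  calc ∫ ω, F (informed P v ω (t + 1)) ∂processLaw G q
      = ∫ z, F (nextInformed P (informedOfRange P v t z.1) z.2)
          ∂((processLaw G q).map fun ω => ((Finset.range t).restrict ω, ω t)) := by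
        rw [integral_map (hrestrict.prodMk (measurable_pi_apply t)).aemeasurable
          (measurable_of_finite _).aestronglyMeasurable]
        simp only [informedOfRange_restrict, informed]
    _ = ∫ x, transition G P q F (informedOfRange P v t x)
          ∂((processLaw G q).map (Finset.range t).restrict) := by
        rw [processLaw_map_restrict_prodMk, integral_prod _ Integrable.of_finite]
        rfl
    _ = ∫ ω, transition G P q F (informed P v ω t) ∂processLaw G q := by
        rw [integral_map hrestrict.aemeasurable (measurable_of_finite _).aestronglyMeasurable]
        simp only [informedOfRange_restrict]

theorem integral_informed (v : V) (t : ℕ) (F : Finset V → ℝ) :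
    ∫ ω, F (informed P v ω t) ∂processLaw G q = (transition G P q ^ t) F {v} := by
  induction t generalizing F with
  | zero => simp [informed]
  | succ t ih => rw [integral_informed_succ, ih, pow_succ, Module.End.mul_apply]

theorem transition_const_add_mul (a b : ℝ) :
    transition G P q (fun J => a + b * F J) I = a + b * transition G P q F I := by
  have haffine : (fun J => a + b * F J) = Function.const _ a + b • F := rfl
  rw [haffine, map_add, map_smul, transition_const]
  rfl

theorem transition_pow_mono (t : ℕ) (h : ∀ J, I ⊆ J → F J ≤ F' J) :
    (transition G P q ^ t) F I ≤ (transition G P q ^ t) F' I := by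
  induction t generalizing I with
  | zero => exact h I subset_rfl
  | succ t ih =>
    rw [pow_succ', Module.End.mul_apply, Module.End.mul_apply]
    exact transition_mono fun J hJ => ih fun J' hJ' => h J' (hJ.trans hJ')

theorem transition_pow_const (t : ℕ) (c : ℝ) :
    (transition G P q ^ t) (Function.const _ c) = Function.const _ c := by
  induction t with
  | zero => rfl
  | succ t ih => rw [pow_succ, Module.End.mul_apply, transition_const, ih]

theorem transition_pow_le_pow_mul {A : Set (Finset V)} (hA : IsUpperSet A) {ρ : ℝ} (hρ : 0 ≤ ρ)
    (hF : ∀ J ∈ A, transition G P q F J ≤ ρ * F J) (hI : I ∈ A) (t : ℕ) :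
    (transition G P q ^ t) F I ≤ ρ ^ t * F I := by
  induction t generalizing I with
  | zero => simp
  | succ t ih =>
    calc (transition G P q ^ (t + 1)) F I
        = transition G P q ((transition G P q ^ t) F) I := by rw [pow_succ', Module.End.mul_apply]
      _ ≤ transition G P q (ρ ^ t • F) I := transition_mono fun J hJ => ih (hA hJ hI)
      _ = ρ ^ t * transition G P q F I := by rw [map_smul]; rfl
      _ ≤ ρ ^ t * (ρ * F I) := by gcongr; exact hF I hI
      _ = ρ ^ (t + 1) * F I := by ring

end Chain

section ProbAfter

variable {V : Type*} [Fintype V] [DecidableEq V] [MeasurableSpace V] [MeasurableSingletonClass V]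
  (G : SimpleGraph V) [DecidableRel G.Adj] (P : Protocol) (q : unitInterval)

/-- The probability that `t` rounds started from the informed set `I` lead to an informed set that
belongs to the family `A`. -/
noncomputable def probAfter (t : ℕ) (A : Set (Finset V)) (I : Finset V) : ℝ :=
  (transition G P q ^ t) (A.indicator 1) I

theorem processLaw_real_informed_mem (v : V) (t : ℕ) (A : Set (Finset V)) :
    (processLaw G q).real {ω | informed P v ω t ∈ A} = probAfter G P q t A {v} := by
  rw [probAfter, ← integral_informed, ← integral_indicator_one (measurableSet_informed_mem P v t A)]
  rfl

variable {G P q} {A B : Set (Finset V)} {F : Finset V → ℝ} {I : Finset V}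

theorem probAfter_le_one (t : ℕ) : probAfter G P q t A I ≤ 1 := by
  have h := transition_pow_mono (G := G) (P := P) (q := q) (I := I) t
    (F' := Function.const _ 1) fun J _ => Set.indicator_le_self' (s := A) (f := 1)
      (fun _ _ => zero_le_one) J
  rwa [transition_pow_const] at h

/-- The Markov property: either the first `s` rounds miss `B`, or the remaining `t` rounds start
in `B`. -/
theorem probAfter_add_le {b : ℝ} (hb : 0 ≤ b) {s t : ℕ}
    (h : ∀ J, I ⊆ J → J ∈ B → probAfter G P q t A J ≤ b) :
    probAfter G P q (s + t) A I ≤ b + probAfter G P q s Bᶜ I := by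
  calc probAfter G P q (s + t) A I
      = (transition G P q ^ s) (probAfter G P q t A) I := by
        rw [probAfter, pow_add, Module.End.mul_apply]; rfl
    _ ≤ (transition G P q ^ s) (Function.const _ b + Bᶜ.indicator 1) I := by
        refine transition_pow_mono s fun J hJ => ?_
        rw [Pi.add_apply, Function.const_apply]
        by_cases hJB : J ∈ B
        · rw [Set.indicator_of_notMem (not_not.2 hJB), add_zero]
          exact h J hJ hJB
        · rw [Set.indicator_of_mem hJB]
          exact (probAfter_le_one t).trans (le_add_of_nonneg_left hb)
    _ = b + probAfter G P q s Bᶜ I := by rw [map_add, transition_pow_const]; rfl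

theorem mul_probAfter_le_transition_pow {x : ℝ} (hF : ∀ J, 0 ≤ F J) (hA : ∀ J ∈ A, x ≤ F J)
    (t : ℕ) : x * probAfter G P q t A I ≤ (transition G P q ^ t) F I := by
  have hsmul : x * probAfter G P q t A I = (transition G P q ^ t) (x • A.indicator 1) I := by
    rw [map_smul]; rfl
  rw [hsmul]
  refine transition_pow_mono t fun J _ => ?_
  by_cases hJ : J ∈ A
  · simpa [hJ] using hA J hJ
  · simpa [hJ] using hF J

theorem probAfter_le_pow_mul_card_div {ρ x : ℝ} (hB : IsUpperSet B) (hρ : 0 ≤ ρ) (hx : 0 < x)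
    (hG : ∀ w, 0 < G.degree w) (hstep : ∀ J ∈ B, meanUninformed G P q J ≤ ρ * Jᶜ.card)
    (hI : I ∈ B) (hA : ∀ J ∈ A, x ≤ Jᶜ.card) (t : ℕ) :
    probAfter G P q t A I ≤ ρ ^ t * (Fintype.card V / x) := by
  rw [← mul_div_assoc, le_div_iff₀' hx]
  calc x * probAfter G P q t A I
      ≤ (transition G P q ^ t) (fun J => (Jᶜ.card : ℝ)) I :=
        mul_probAfter_le_transition_pow (fun _ => Nat.cast_nonneg _) hA t
    _ ≤ ρ ^ t * Iᶜ.card :=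
        transition_pow_le_pow_mul hB hρ
          (fun J hJ => (transition_card_compl hG).trans_le (hstep J hJ)) hI t
    _ ≤ ρ ^ t * Fintype.card V := by gcongr; exact Finset.card_le_univ _

end ProbAfter

section FirstMoment

variable {V : Type*} [Fintype V] [DecidableEq V]

theorem card_add_card_compl_cast (J : Finset V) : (J.card : ℝ) + Jᶜ.card = Fintype.card V := by
  exact_mod_cast J.card_add_card_compl

variable [MeasurableSpace V] [MeasurableSingletonClass V]
  {G : SimpleGraph V} [DecidableRel G.Adj] {P : Protocol} {q : unitInterval} {I : Finset V}

theorem transition_card (hG : ∀ w, 0 < G.degree w) :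
    transition G P q (fun J => (J.card : ℝ)) I =
      I.card + (Iᶜ.card - meanUninformed G P q I) := by
  have hcard : (fun J : Finset V => (J.card : ℝ)) =
      fun J => (Fintype.card V : ℝ) + (-1) * (Jᶜ.card : ℝ) := by
    ext J
    linarith [card_add_card_compl_cast J]
  rw [hcard, transition_const_add_mul, transition_card_compl hG]
  linarith [card_add_card_compl_cast I]

theorem IsQuasirandom.transition_pow_card_le {η : ℝ} (h : IsQuasirandom G η) (t : ℕ) :
    (transition G P q ^ t) (fun J => (J.card : ℝ)) I ≤
      (1 + growthRate P q * (1 + η)) ^ t * I.card := by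
  have hc := growthRate_nonneg P q.2
  have hη := h.eta_pos
  refine transition_pow_le_pow_mul isUpperSet_univ (by positivity) (fun J _ => ?_)
    (Set.mem_univ I) t
  rw [transition_card h.degree_pos, one_add_mul]
  gcongr
  exact h.card_compl_sub_meanUninformed_le

end FirstMoment

section SecondMoment

variable {V : Type*} [Fintype V] [DecidableEq V] {G : SimpleGraph V} [DecidableRel G.Adj]
  {P : Protocol} {q : unitInterval} {I : Finset V}

theorem mul_card_compl_le_meanUninformed {p : ℝ} (hstay : ∀ u ∉ I, p ≤ stayProb G P q I u) :
    p * Iᶜ.card ≤ meanUninformed G P q I := by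
  rw [mul_comm, ← nsmul_eq_mul]
  exact Finset.card_nsmul_le_sum _ _ _ fun u hu => hstay u (Finset.mem_compl.1 hu)

variable [MeasurableSpace V] [MeasurableSingletonClass V]

theorem transition_sq_sub_meanUninformed_le_card_compl (hG : ∀ w, 0 < G.degree w) :
    transition G P q (fun J => ((Jᶜ.card : ℝ) - meanUninformed G P q I) ^ 2) I ≤ Iᶜ.card := by
  refine (transition_sq_sub_meanUninformed_le hG).trans ?_
  rw [← nsmul_one]
  refine Finset.sum_le_card_nsmul _ _ _ fun u hu => ?_
  obtain ⟨hnonneg, hle⟩ := stayProb_mem_Icc P q hG (Finset.mem_compl.1 hu)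
  exact mul_le_one₀ hle (sub_nonneg.2 hle) (sub_le_self 1 hnonneg)

/-- Chebyshev's inequality, for a function `F` that is at most `a` unless `D` deviates by `d`. -/
theorem transition_le_add_mul_div_sq {F D : Finset V → ℝ} {a c d σ : ℝ} (ha : 0 ≤ a) (hc : 0 ≤ c)
    (hd : 0 < d) (hgood : ∀ J, I ⊆ J → |D J| < d → F J ≤ a) (hbad : ∀ J, I ⊆ J → F J ≤ c)
    (hvar : transition G P q (fun J => D J ^ 2) I ≤ σ) :
    transition G P q F I ≤ a + c / d ^ 2 * σ := by
  calc transition G P q F I ≤ transition G P q (fun J => a + c / d ^ 2 * D J ^ 2) I := by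
        refine transition_mono fun J hJ => ?_
        by_cases hD : |D J| < d
        · exact (hgood J hJ hD).trans (le_add_of_nonneg_right (by positivity))
        · have hsq : d ^ 2 ≤ D J ^ 2 := sq_le_sq.2 ((abs_of_pos hd).trans_le (not_lt.1 hD))
          calc F J ≤ c / d ^ 2 * d ^ 2 := (hbad J hJ).trans_eq (by field_simp)
            _ ≤ c / d ^ 2 * D J ^ 2 := by gcongr
            _ ≤ a + c / d ^ 2 * D J ^ 2 := le_add_of_nonneg_left ha
    _ = a + c / d ^ 2 * transition G P q (fun J => D J ^ 2) I := transition_const_add_mul _ _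
    _ ≤ a + c / d ^ 2 * σ := by gcongr

/-- With high probability, the number of uninformed vertices shrinks in each round by no more than
the factor `p₁`. -/
theorem probAfter_univ_le (hG : ∀ w, 0 < G.degree w) {p₀ p₁ m : ℝ} (hp₁ : 0 < p₁) (hp : p₁ < p₀)
    (hp₀ : p₀ ≤ 1) (hm : 0 < m) (hstay : ∀ I, ∀ u ∉ I, p₀ ≤ stayProb G P q I u) (t : ℕ)
    (hI : m ≤ Iᶜ.card * p₁ ^ t) :
    probAfter G P q t {Finset.univ} I ≤ t / ((p₀ - p₁) ^ 2 * m) := by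
  induction t generalizing I with
  | zero =>
    have hne : I ≠ Finset.univ := by
      rintro rfl
      simp only [Finset.compl_univ, Finset.card_empty, Nat.cast_zero, zero_mul] at hI
      exact hm.not_ge hI
    simp [probAfter, hne]
  | succ t ih =>
    have hml : m ≤ Iᶜ.card := hI.trans
      (mul_le_of_le_one_right (Nat.cast_nonneg _) (pow_le_one₀ hp₁.le (hp.le.trans hp₀)))
    have hw : 0 < p₀ - p₁ := sub_pos.2 hp
    have hl : (0 : ℝ) < Iᶜ.card := hm.trans_le hml
    have hmean := mul_card_compl_le_meanUninformed (hstay I)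
    calc probAfter G P q (t + 1) {Finset.univ} I
        = transition G P q (probAfter G P q t {Finset.univ}) I := by
          rw [probAfter, pow_succ', Module.End.mul_apply]; rfl
      _ ≤ t / ((p₀ - p₁) ^ 2 * m) + 1 / ((p₀ - p₁) * Iᶜ.card) ^ 2 * Iᶜ.card := by
          refine transition_le_add_mul_div_sq (by positivity) zero_le_one (by positivity)
            (fun J _ hJ => ih ?_) (fun J _ => probAfter_le_one t)
            (transition_sq_sub_meanUninformed_le_card_compl hG)
          have hshrink : p₁ * Iᶜ.card ≤ Jᶜ.card := by linarith [(abs_lt.1 hJ).1]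
          calc m ≤ p₁ * Iᶜ.card * p₁ ^ t := hI.trans_eq (by ring)
            _ ≤ Jᶜ.card * p₁ ^ t := by gcongr
      _ = t / ((p₀ - p₁) ^ 2 * m) + 1 / ((p₀ - p₁) ^ 2 * Iᶜ.card) := by field_simp
      _ ≤ t / ((p₀ - p₁) ^ 2 * m) + 1 / ((p₀ - p₁) ^ 2 * m) := by gcongr
      _ = (t + 1 : ℕ) / ((p₀ - p₁) ^ 2 * m) := by rw [← add_div, Nat.cast_add_one]

end SecondMoment

/-! ### The start of the growth phase -/

/-- A decreasing weight: `j ^ (-s)` for `j ≥ K`, with an extra factor `2` for each step below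
`K`. Above `K` the number of informed vertices is concentrated and the power decay yields the
optimal rate; below `K` the factor `2` rewards a single newly informed vertex. -/
noncomputable def startWeight (K : ℕ) (s : ℝ) (j : ℕ) : ℝ :=
  2 ^ (K - j) * ((max j K : ℕ) : ℝ) ^ (-s)

section StartWeight

variable {K : ℕ} {s : ℝ} {i j : ℕ}

theorem startWeight_nonneg (K : ℕ) (s : ℝ) (j : ℕ) : 0 ≤ startWeight K s j := by
  unfold startWeight; positivity

theorem startWeight_of_le (hKj : K ≤ j) : startWeight K s j = (j : ℝ) ^ (-s) := by
  simp [startWeight, hKj]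

theorem rpow_neg_max_anti (hK : 0 < K) (hs : 0 ≤ s) (hij : i ≤ j) :
    ((max j K : ℕ) : ℝ) ^ (-s) ≤ ((max i K : ℕ) : ℝ) ^ (-s) := by
  refine Real.rpow_le_rpow_of_nonpos ?_ ?_ (neg_nonpos.2 hs)
  · exact_mod_cast lt_max_of_lt_right hK
  · exact_mod_cast max_le_max_right _ hij

theorem startWeight_anti (hK : 0 < K) (hs : 0 ≤ s) (hij : i ≤ j) :
    startWeight K s j ≤ startWeight K s i :=
  mul_le_mul (pow_le_pow_right₀ one_le_two (by omega)) (rpow_neg_max_anti hK hs hij)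
    (by positivity) (by positivity)

theorem startWeight_le_half (hK : 0 < K) (hs : 0 ≤ s) (hij : i < j) (hiK : i < K) :
    startWeight K s j ≤ startWeight K s i * (1 / 2) := by
  have hpow : (2 : ℝ) ^ (K - j) ≤ 2 ^ (K - i) * (1 / 2) := by
    rw [← div_eq_mul_one_div, le_div_iff₀ two_pos, ← pow_succ]
    exact pow_le_pow_right₀ one_le_two (by omega)
  calc startWeight K s j ≤ (2 ^ (K - i) * (1 / 2)) * ((max i K : ℕ) : ℝ) ^ (-s) :=
        mul_le_mul hpow (rpow_neg_max_anti hK hs hij.le) (by positivity) (by positivity)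
    _ = startWeight K s i * (1 / 2) := by rw [startWeight]; ring

theorem rpow_neg_le_startWeight (hK : 0 < K) (hs : 0 ≤ s) {n : ℕ} (hn : 0 < n) (hjn : j ≤ n) :
    ((K : ℝ) * n) ^ (-s) ≤ startWeight K s j := by
  have hmax : max j K ≤ K * n :=
    max_le (hjn.trans (Nat.le_mul_of_pos_left n hK)) (Nat.le_mul_of_pos_right K hn)
  calc ((K : ℝ) * n) ^ (-s) ≤ ((max j K : ℕ) : ℝ) ^ (-s) :=
        Real.rpow_le_rpow_of_nonpos (by exact_mod_cast lt_max_of_lt_right hK)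
          (by exact_mod_cast hmax) (neg_nonpos.2 hs)
    _ ≤ startWeight K s j :=
        le_mul_of_one_le_left (by positivity) (one_le_pow₀ one_le_two)

theorem startWeight_one_le (K : ℕ) (hs : 0 ≤ s) : startWeight K s 1 ≤ 2 ^ K := by
  have hrpow : ((max 1 K : ℕ) : ℝ) ^ (-s) ≤ 1 :=
    Real.rpow_le_one_of_one_le_of_nonpos (by exact_mod_cast le_max_left 1 K) (neg_nonpos.2 hs)
  calc startWeight K s 1 ≤ 2 ^ (K - 1) * 1 := mul_le_mul_of_nonneg_left hrpow (by positivity)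
    _ ≤ 2 ^ K := by rw [mul_one]; exact pow_le_pow_right₀ one_le_two (K.sub_le 1)

end StartWeight

section StartPotential

variable {V : Type*} [Fintype V] {η : ℝ}

/-- The weight of a set of at most `η n` informed vertices, and `0` for larger sets. -/
noncomputable def startPotential (V : Type*) [Fintype V] (η : ℝ) (K : ℕ) (s : ℝ) (I : Finset V) :
    ℝ :=
  if (I.card : ℝ) ≤ η * Fintype.card V then startWeight K s I.card else 0

theorem startPotential_nonneg (K : ℕ) (s : ℝ) (I : Finset V) : 0 ≤ startPotential V η K s I := by
  rw [startPotential]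
  split_ifs
  exacts [startWeight_nonneg K s _, le_rfl]

theorem startPotential_le_startWeight (K : ℕ) (s : ℝ) (I : Finset V) :
    startPotential V η K s I ≤ startWeight K s I.card := by
  rw [startPotential]
  split_ifs
  exacts [le_rfl, startWeight_nonneg K s _]

theorem startPotential_of_le {K : ℕ} {s : ℝ} {I : Finset V}
    (hI : (I.card : ℝ) ≤ η * Fintype.card V) :
    startPotential V η K s I = startWeight K s I.card := if_pos hI

theorem startPotential_of_lt {K : ℕ} {s : ℝ} {I : Finset V}
    (hI : η * Fintype.card V < I.card) : startPotential V η K s I = 0 := if_neg hI.not_ge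

end StartPotential

section Startup

variable {V : Type*} [Fintype V] [DecidableEq V] {G : SimpleGraph V} [DecidableRel G.Adj]
  {P : Protocol} {q : unitInterval} {I : Finset V} {η b w s ρ : ℝ} {K : ℕ}

theorem IsQuasirandom.card_compl_sub_meanUninformed_le_four_mul (h : IsQuasirandom G η)
    (hη : η ≤ 1 / 2) : (Iᶜ.card : ℝ) - meanUninformed G P q I ≤ 4 * I.card := by
  refine h.card_compl_sub_meanUninformed_le.trans ?_
  gcongr
  nlinarith [growthRate_nonneg P q.2, growthRate_le_two P q.2]

variable [MeasurableSpace V] [MeasurableSingletonClass V]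

theorem IsQuasirandom.transition_sq_sub_meanUninformed_le_four_mul (h : IsQuasirandom G η)
    (hη : η ≤ 1 / 2) :
    transition G P q (fun J => ((Jᶜ.card : ℝ) - meanUninformed G P q I) ^ 2) I ≤ 4 * I.card := by
  calc transition G P q (fun J => ((Jᶜ.card : ℝ) - meanUninformed G P q I) ^ 2) I
      ≤ ∑ u ∈ Iᶜ, stayProb G P q I u * (1 - stayProb G P q I u) :=
        transition_sq_sub_meanUninformed_le h.degree_pos
    _ ≤ ∑ u ∈ Iᶜ, (1 - stayProb G P q I u) := by
        refine Finset.sum_le_sum fun u hu => ?_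
        have hle := (stayProb_mem_Icc P q h.degree_pos (Finset.mem_compl.1 hu)).2
        exact mul_le_of_le_one_left (sub_nonneg.2 hle) hle
    _ ≤ 4 * I.card := by
        rw [← card_compl_sub_meanUninformed]
        exact h.card_compl_sub_meanUninformed_le_four_mul hη

theorem transition_card_sub_card (hG : ∀ w, 0 < G.degree w) :
    transition G P q (fun J => (J.card : ℝ) - I.card) I = Iᶜ.card - meanUninformed G P q I := by
  have haffine : (fun J : Finset V => (J.card : ℝ) - I.card) =
      fun J => -(I.card : ℝ) + 1 * (J.card : ℝ) := by ext J; ring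
  rw [haffine, transition_const_add_mul, transition_card hG]
  ring

theorem IsQuasirandom.transition_sq_card_sub_card_le (h : IsQuasirandom G η) (hη : η ≤ 1 / 2)
    (hI : I.Nonempty) (hmean : meanUninformed G P q I ≤ Iᶜ.card) :
    transition G P q (fun J => ((J.card : ℝ) - I.card) ^ 2) I ≤ 40 * (I.card : ℝ) ^ 2 := by
  set μ : ℝ := Iᶜ.card - meanUninformed G P q I
  have hμ_le : μ ≤ 4 * I.card := h.card_compl_sub_meanUninformed_le_four_mul hη
  have : 0 ≤ μ := sub_nonneg.2 hmean
  have hcard : (1 : ℝ) ≤ I.card := Nat.one_le_cast.2 hI.card_pos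
  calc transition G P q (fun J => ((J.card : ℝ) - I.card) ^ 2) I
      ≤ transition G P q (fun J => 2 * μ ^ 2 +
          2 * ((Jᶜ.card : ℝ) - meanUninformed G P q I) ^ 2) I := by
        refine transition_mono fun J _ => ?_
        have hsub : (J.card : ℝ) - I.card = μ - (Jᶜ.card - meanUninformed G P q I) := by
          linarith [card_add_card_compl_cast J, card_add_card_compl_cast I]
        rw [hsub]
        linarith [sq_nonneg (μ + (Jᶜ.card - meanUninformed G P q I))]
    _ ≤ 2 * μ ^ 2 + 2 * (4 * I.card) := by
        rw [transition_const_add_mul]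
        gcongr
        exact h.transition_sq_sub_meanUninformed_le_four_mul hη
    _ ≤ 40 * (I.card : ℝ) ^ 2 := by nlinarith

theorem transition_startPotential_eq_zero (hI : η * Fintype.card V < I.card) :
    transition G P q (startPotential V η K s) I = 0 := by
  have hzero (J : Finset V) (hJ : I ⊆ J) : startPotential V η K s J = 0 :=
    startPotential_of_lt (hI.trans_le (Nat.cast_le.2 (Finset.card_le_card hJ)))
  rw [transition_congr (F' := 0) hzero, map_zero]
  rfl

/-- By Chebyshev, at least `b |I|` new vertices are informed, except with probability
`4 / (w ^ 2 |I|)`. -/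
theorem IsQuasirandom.transition_startPotential_le_of_le_card (h : IsQuasirandom G η)
    (hη : η ≤ 1 / 2) (hK : 0 < K) (hs : 0 ≤ s) (hb : 0 ≤ b) (hw : 0 < w)
    (hmean : (b + w) * I.card ≤ Iᶜ.card - meanUninformed G P q I) (hKI : K ≤ I.card) :
    transition G P q (startPotential V η K s) I ≤
      ((1 + b) ^ (-s) + 4 / (w ^ 2 * K)) * startWeight K s I.card := by
  set f₀ := startWeight K s I.card with hf₀
  have hf₀_nonneg : 0 ≤ f₀ := startWeight_nonneg K s _
  have hK' : (0 : ℝ) < K := Nat.cast_pos.2 hK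
  have hKI' : (K : ℝ) ≤ I.card := Nat.cast_le.2 hKI
  have hI : (0 : ℝ) < I.card := hK'.trans_le hKI'
  calc transition G P q (startPotential V η K s) I
      ≤ f₀ * (1 + b) ^ (-s) + f₀ / (w * I.card) ^ 2 * (4 * I.card) := by
        refine transition_le_add_mul_div_sq (by positivity) hf₀_nonneg (by positivity)
          (fun J hJ hdev => (startPotential_le_startWeight K s J).trans ?_)
          (fun J hJ => (startPotential_le_startWeight K s J).trans
            (startWeight_anti hK hs (Finset.card_le_card hJ)))
          (h.transition_sq_sub_meanUninformed_le_four_mul hη)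
        have hgrowth : (I.card : ℝ) * (1 + b) ≤ J.card := by
          linarith [(abs_lt.1 hdev).2, card_add_card_compl_cast I, card_add_card_compl_cast J]
        rw [startWeight_of_le (hKI.trans (Finset.card_le_card hJ)), hf₀, startWeight_of_le hKI,
          ← Real.mul_rpow hI.le (by positivity)]
        exact Real.rpow_le_rpow_of_nonpos (by positivity) hgrowth (neg_nonpos.2 hs)
    _ = ((1 + b) ^ (-s) + 4 / (w ^ 2 * I.card)) * f₀ := by field_simp
    _ ≤ ((1 + b) ^ (-s) + 4 / (w ^ 2 * K)) * f₀ := by gcongr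

theorem startWeight_le_quadratic {k : ℕ} (hK : 0 < K) (hs : 0 ≤ s) (hkK : k < K) (τ : ℝ) {j : ℕ}
    (hkj : k ≤ j) :
    startWeight K s j ≤ startWeight K s k * (1 - τ * ((j : ℝ) - k) +
      τ ^ 2 / 2 * ((j : ℝ) - k) ^ 2) := by
  obtain rfl | hlt := hkj.eq_or_lt
  · simp
  · refine (startWeight_le_half hK hs hlt hkK).trans ?_
    gcongr
    · exact startWeight_nonneg K s k
    · linarith [sq_nonneg (τ * ((j : ℝ) - k) - 1)]

/-- The first two moments of the number of newly informed vertices show that it is positive with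
probability bounded away from `0`. -/
theorem IsQuasirandom.transition_startPotential_le_of_card_lt (h : IsQuasirandom G η)
    (hη : η ≤ 1 / 2) {c : ℝ} (hs : 0 ≤ s) (hc : 0 ≤ c)
    (hmean : c * I.card ≤ Iᶜ.card - meanUninformed G P q I) (hI : I.Nonempty) (hIK : I.card < K) :
    transition G P q (startPotential V η K s) I ≤
      (1 - c ^ 2 / 80) * startWeight K s I.card := by
  set f₀ := startWeight K s I.card
  have hf₀ : 0 ≤ f₀ := startWeight_nonneg K s _
  have hcard : (0 : ℝ) < I.card := Nat.cast_pos.2 hI.card_pos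
  set τ := c / (40 * I.card) with hτ
  have : 0 ≤ τ := by positivity
  set X : Finset V → ℝ := fun J => (J.card : ℝ) - I.card
  have hquadratic : (fun J => f₀ * (1 - τ * X J + τ ^ 2 / 2 * X J ^ 2)) =
      f₀ • (Function.const _ 1 - τ • X + (τ ^ 2 / 2) • fun J => X J ^ 2) := rfl
  have hsq : transition G P q (fun J => X J ^ 2) I ≤ 40 * (I.card : ℝ) ^ 2 :=
    h.transition_sq_card_sub_card_le hη hI
      (sub_nonneg.1 ((mul_nonneg hc hcard.le).trans hmean))
  calc transition G P q (startPotential V η K s) I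
      ≤ transition G P q (fun J => f₀ * (1 - τ * X J + τ ^ 2 / 2 * X J ^ 2)) I :=
        transition_mono fun J hJ => (startPotential_le_startWeight K s J).trans
          (startWeight_le_quadratic (hI.card_pos.trans hIK) hs hIK τ (Finset.card_le_card hJ))
    _ = f₀ * (1 - τ * (Iᶜ.card - meanUninformed G P q I) +
          τ ^ 2 / 2 * transition G P q (fun J => X J ^ 2) I) := by
        rw [hquadratic, map_smul, map_add, map_sub, map_smul, map_smul, transition_const,
          ← transition_card_sub_card h.degree_pos]
        rfl
    _ ≤ f₀ * (1 - τ * (c * I.card) + τ ^ 2 / 2 * (40 * (I.card : ℝ) ^ 2)) := by gcongr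
    _ = (1 - c ^ 2 / 80) * f₀ := by rw [hτ]; field_simp; ring

theorem IsQuasirandom.transition_startPotential_le (h : IsQuasirandom G η) (hη : η ≤ 1 / 2)
    (hK : 0 < K) (hs : 0 ≤ s) (hb : 0 ≤ b) (hw : 0 < w)
    (hbw : b + w ≤ growthRate P q * (1 - √(2 * η) - 3 * η))
    (hρ_large : (1 + b) ^ (-s) + 4 / (w ^ 2 * K) ≤ ρ) (hρ_small : 1 - (b + w) ^ 2 / 80 ≤ ρ)
    (hI : I.Nonempty) :
    transition G P q (startPotential V η K s) I ≤ ρ * startPotential V η K s I := by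
  obtain hIη | hIη := lt_or_ge (η * Fintype.card V) I.card
  · rw [transition_startPotential_eq_zero hIη, startPotential_of_lt hIη, mul_zero]
  have hmean : (b + w) * I.card ≤ Iᶜ.card - meanUninformed G P q I :=
    calc (b + w) * I.card ≤ growthRate P q * (1 - √(2 * η) - 3 * η) * I.card := by gcongr
      _ = growthRate P q * I.card * (1 - √(2 * η) - 3 * η) := by ring
      _ ≤ Iᶜ.card - meanUninformed G P q I := h.le_card_compl_sub_meanUninformed hη hIη
  have hweight := startWeight_nonneg K s I.card
  rw [startPotential_of_le hIη]
  obtain hKI | hIK := le_or_gt K I.card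
  · exact (h.transition_startPotential_le_of_le_card hη hK hs hb hw hmean hKI).trans (by gcongr)
  · exact (h.transition_startPotential_le_of_card_lt hη hs (by positivity) hmean hI hIK).trans
      (by gcongr)

theorem IsQuasirandom.probAfter_card_le_le (h : IsQuasirandom G η) (hη : η ≤ 1 / 2)
    (hK : 0 < K) (hs : 0 ≤ s) (hb : 0 ≤ b) (hw : 0 < w)
    (hbw : b + w ≤ growthRate P q * (1 - √(2 * η) - 3 * η))
    (hρ_large : (1 + b) ^ (-s) + 4 / (w ^ 2 * K) ≤ ρ) (hρ_small : 1 - (b + w) ^ 2 / 80 ≤ ρ)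
    (v : V) (t : ℕ) :
    probAfter G P q t {J | (J.card : ℝ) ≤ η * Fintype.card V} {v} ≤
      ((K : ℝ) * Fintype.card V) ^ s * (ρ ^ t * 2 ^ K) := by
  have hρ : 0 ≤ ρ := le_trans (by positivity) hρ_large
  have hn : 0 < Fintype.card V := Fintype.card_pos_iff.2 ⟨v⟩
  have hKn : (0 : ℝ) < K * Fintype.card V := by exact_mod_cast Nat.mul_pos hK hn
  have hupper : IsUpperSet {J : Finset V | J.Nonempty} := fun _ _ hIJ hI => hI.mono hIJ
  rw [← div_le_iff₀' (by positivity), div_eq_inv_mul, ← Real.rpow_neg hKn.le]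
  calc ((K : ℝ) * Fintype.card V) ^ (-s) *
        probAfter G P q t {J | (J.card : ℝ) ≤ η * Fintype.card V} {v}
      ≤ (transition G P q ^ t) (startPotential V η K s) {v} :=
        mul_probAfter_le_transition_pow (startPotential_nonneg K s)
          (fun J hJ => (rpow_neg_le_startWeight hK hs hn J.card_le_univ).trans_eq
            (startPotential_of_le hJ).symm) t
    _ ≤ ρ ^ t * startPotential V η K s {v} :=
        transition_pow_le_pow_mul hupper hρ (fun I hI =>
          h.transition_startPotential_le hη hK hs hb hw hbw hρ_large hρ_small hI)
          (Finset.singleton_nonempty v) t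
    _ ≤ ρ ^ t * 2 ^ K := by
        gcongr
        exact (startPotential_le_startWeight K s {v}).trans (startWeight_one_le K hs)

end Startup

/-! ### Logarithmically many rounds -/

section Rates

variable (P : Protocol) {q : ℝ}

theorem shrinkRate_nonneg (hq : q ∈ Set.Icc (0 : ℝ) 1) : 0 ≤ shrinkRate P q :=
  mul_nonneg (sub_nonneg.2 (pullRate_mem_Icc P hq).2) (Real.exp_nonneg _)

theorem shrinkRate_lt_one (hq : 0 < q) : shrinkRate P q < 1 := by
  have hexp : Real.exp (-q) < 1 := Real.exp_lt_one_iff.2 (neg_lt_zero.2 hq)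
  cases P <;> simp only [shrinkRate, pullRate, pushRate]
  · linarith
  · simpa using hq
  · nlinarith [Real.exp_pos (-q)]

theorem one_div_neg_log_shrinkRate_nonneg (hq0 : 0 < q) (hq1 : q ≤ 1) :
    0 ≤ 1 / -Real.log (shrinkRate P q) :=
  one_div_nonneg.2 (neg_nonneg.2
    (Real.log_nonpos (shrinkRate_nonneg P ⟨hq0.le, hq1⟩) (shrinkRate_lt_one P hq0).le))

theorem log_one_add_growthRate_pos (hq : 0 < q) : 0 < Real.log (1 + growthRate P q) :=
  Real.log_pos (by linarith [growthRate_pos P hq])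

/-- For `q = 1` in pull and push&pull, `shrinkRate P q = 0` and the second summand is `1 / 0 = 0`,
in accordance with the limit `q → 1`. -/
theorem runtimeConst_eq (hq : q ≤ 1) :
    runtimeConst P q = 1 / Real.log (1 + growthRate P q) + 1 / -Real.log (shrinkRate P q) := by
  obtain rfl | hq := hq.eq_or_lt
  · cases P <;> simp [runtimeConst, growthRate, shrinkRate, pushRate, pullRate] <;> norm_num
  · have hlog : Real.log ((1 - q) * Real.exp (-q)) = Real.log (1 - q) - q := by
      rw [Real.log_mul (sub_pos.2 hq).ne' (Real.exp_ne_zero _), Real.log_exp, ← sub_eq_add_neg]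
    cases P
    · simp [runtimeConst, growthRate, shrinkRate, pushRate, pullRate]
    · simp only [runtimeConst, growthRate, shrinkRate, pushRate, pullRate, hq.ne, if_false,
        zero_add, neg_zero, Real.exp_zero, mul_one, div_neg, sub_eq_add_neg]
    · simp only [runtimeConst, growthRate, shrinkRate, pushRate, pullRate, hq.ne, if_false, hlog,
        neg_sub, two_mul]

theorem runtimeConst_pos (hq0 : 0 < q) (hq1 : q ≤ 1) : 0 < runtimeConst P q := by
  rw [runtimeConst_eq P hq1]
  exact add_pos_of_pos_of_nonneg (one_div_pos.2 (log_one_add_growthRate_pos P hq0))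
    (one_div_neg_log_shrinkRate_nonneg P hq0 hq1)

end Rates

theorem lt_exp_neg_one_div_of_one_div_neg_log_lt {ρ τ : ℝ} (hρ : 0 ≤ ρ) (hρ1 : ρ < 1)
    (hτ : 0 < τ) (h : 1 / -Real.log ρ < τ) : ρ < Real.exp (-(1 / τ)) := by
  obtain rfl | hρ := hρ.eq_or_lt
  · exact Real.exp_pos _
  · rw [one_div_lt (neg_pos.2 (Real.log_neg hρ hρ1)) hτ] at h
    exact (Real.log_lt_iff_lt_exp hρ).1 (lt_neg_of_lt_neg h)

theorem exp_neg_one_div_lt_of_lt_one_div_neg_log {ρ τ : ℝ} (hρ : 0 < ρ) (hρ1 : ρ < 1)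
    (hτ : 0 < τ) (h : τ < 1 / -Real.log ρ) : Real.exp (-(1 / τ)) < ρ := by
  rw [lt_one_div hτ (neg_pos.2 (Real.log_neg hρ hρ1))] at h
  exact (Real.lt_log_iff_exp_lt hρ).1 (neg_lt_of_neg_lt h)

/-- The number of rounds `⌈τ log n⌉`, in which the phases of the process are measured. -/
noncomputable def logRounds (τ : ℝ) (n : ℕ) : ℕ := ⌈τ * Real.log n⌉₊

section LogRounds

variable {τ ρ κ : ℝ} {n : ℕ}

theorem le_logRounds (τ : ℝ) (n : ℕ) : τ * Real.log n ≤ logRounds τ n := Nat.le_ceil _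

theorem logRounds_le (hτ : 0 ≤ τ) (n : ℕ) : (logRounds τ n : ℝ) ≤ τ * Real.log n + 1 :=
  (Nat.ceil_lt_add_one (mul_nonneg hτ (Real.log_natCast_nonneg n))).le

theorem tendsto_log_natCast_atTop : Tendsto (fun n : ℕ => Real.log n) atTop atTop :=
  Real.tendsto_log_atTop.comp tendsto_natCast_atTop_atTop

theorem tendsto_logRounds (hτ : 0 < τ) : Tendsto (logRounds τ) atTop atTop :=
  tendsto_nat_ceil_atTop.comp (tendsto_log_natCast_atTop.const_mul_atTop hτ)

theorem tendsto_natCast_rpow_neg (hκ : 0 < κ) :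
    Tendsto (fun n : ℕ => (n : ℝ) ^ (-κ)) atTop (𝓝 0) :=
  (tendsto_rpow_neg_atTop hκ).comp tendsto_natCast_atTop_atTop

theorem pow_logRounds_eq_exp (hρ : 0 < ρ) (τ : ℝ) (n : ℕ) :
    ρ ^ logRounds τ n = Real.exp (Real.log ρ * logRounds τ n) := by
  rw [mul_comm, Real.exp_nat_mul, Real.exp_log hρ]

theorem pow_logRounds_le_rpow (hρ : 0 < ρ) (hρ1 : ρ ≤ 1) (hn : n ≠ 0) :
    ρ ^ logRounds τ n ≤ (n : ℝ) ^ (τ * Real.log ρ) := by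
  rw [pow_logRounds_eq_exp hρ, Real.rpow_def_of_pos (by positivity), Real.exp_le_exp]
  linarith [mul_le_mul_of_nonpos_left (le_logRounds τ n) (Real.log_nonpos hρ.le hρ1)]

theorem pow_logRounds_le_mul_rpow (hρ : 1 ≤ ρ) (hτ : 0 ≤ τ) (hn : n ≠ 0) :
    ρ ^ logRounds τ n ≤ ρ * (n : ℝ) ^ (τ * Real.log ρ) := by
  have hρ0 : 0 < ρ := zero_lt_one.trans_le hρ
  nth_rewrite 2 [← Real.exp_log hρ0]
  rw [pow_logRounds_eq_exp hρ0, Real.rpow_def_of_pos (by positivity), ← Real.exp_add,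
    Real.exp_le_exp]
  linarith [mul_le_mul_of_nonneg_left (logRounds_le hτ n) (Real.log_nonneg hρ)]

theorem mul_rpow_le_pow_logRounds (hρ : 0 < ρ) (hρ1 : ρ ≤ 1) (hτ : 0 ≤ τ) (hn : n ≠ 0) :
    ρ * (n : ℝ) ^ (τ * Real.log ρ) ≤ ρ ^ logRounds τ n := by
  nth_rewrite 1 [← Real.exp_log hρ]
  rw [pow_logRounds_eq_exp hρ, Real.rpow_def_of_pos (by positivity), ← Real.exp_add,
    Real.exp_le_exp]
  linarith [mul_le_mul_of_nonpos_left (logRounds_le hτ n) (Real.log_nonpos hρ.le hρ1)]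

theorem tendsto_pow_logRounds_mul (hρ : 0 < ρ) (hτ : 0 < τ) (h : ρ < Real.exp (-(1 / τ))) :
    Tendsto (fun n : ℕ => ρ ^ logRounds τ n * n) atTop (𝓝 0) := by
  have hlog : Real.log ρ < -(1 / τ) := (Real.log_lt_iff_lt_exp hρ).2 h
  have hκ : 0 < -(τ * Real.log ρ + 1) := by
    have := mul_lt_mul_of_pos_left hlog hτ
    rw [mul_neg, mul_one_div_cancel hτ.ne'] at this
    linarith
  have hρ1 : ρ ≤ 1 := h.le.trans (Real.exp_le_one_iff.2 (neg_nonpos.2 (by positivity)))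
  refine squeeze_zero' (Eventually.of_forall fun n => by positivity) ?_
    (tendsto_natCast_rpow_neg hκ)
  filter_upwards [eventually_ne_atTop 0] with n hn
  rw [neg_neg, Real.rpow_add_one (Nat.cast_ne_zero.2 hn)]
  gcongr
  exact pow_logRounds_le_rpow hρ hρ1 hn

theorem tendsto_pow_logRounds_div (hρ : 1 ≤ ρ) (hτ : 0 < τ) (h : ρ < Real.exp (1 / τ)) :
    Tendsto (fun n : ℕ => ρ ^ logRounds τ n / n) atTop (𝓝 0) := by
  have hlog : Real.log ρ < 1 / τ := (Real.log_lt_iff_lt_exp (zero_lt_one.trans_le hρ)).2 h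
  have hκ : 0 < -(τ * Real.log ρ - 1) := by
    rw [lt_div_iff₀' hτ] at hlog
    linarith
  have hlim := (tendsto_natCast_rpow_neg hκ).const_mul ρ
  rw [mul_zero] at hlim
  refine squeeze_zero' (Eventually.of_forall fun n => by positivity) ?_ hlim
  filter_upwards [eventually_ne_atTop 0] with n hn
  rw [neg_neg, Real.rpow_sub_one (Nat.cast_ne_zero.2 hn), ← mul_div_assoc]
  gcongr
  exact pow_logRounds_le_mul_rpow hρ hτ.le hn

theorem tendsto_logRounds_div_mul_pow_logRounds (hρ : 0 < ρ) (hρ1 : ρ ≤ 1) (hτ : 0 < τ)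
    (h : Real.exp (-(1 / τ)) < ρ) :
    Tendsto (fun n : ℕ => logRounds τ n / (n * ρ ^ logRounds τ n)) atTop (𝓝 0) := by
  have hlog : -(1 / τ) < Real.log ρ := (Real.lt_log_iff_exp_lt hρ).2 h
  set κ := τ * Real.log ρ + 1 with hκ_def
  have hκ : 0 < κ := by
    have := mul_lt_mul_of_pos_left hlog hτ
    rw [mul_neg, mul_one_div_cancel hτ.ne'] at this
    linarith
  have hlim : Tendsto (fun n : ℕ => (τ * Real.log n + 1) / (ρ * (n : ℝ) ^ κ)) atTop (𝓝 0) := by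
    have hlog_div := (isLittleO_log_rpow_atTop hκ).tendsto_div_nhds_zero.comp
      tendsto_natCast_atTop_atTop
    have hsum := ((hlog_div.const_mul τ).add (tendsto_natCast_rpow_neg hκ)).const_mul ρ⁻¹
    rw [mul_zero, zero_add, mul_zero] at hsum
    refine hsum.congr fun n => ?_
    rw [Function.comp_apply, Real.rpow_neg (Nat.cast_nonneg n), ← div_div, add_div, ← mul_div_assoc]
    ring
  refine squeeze_zero' (Eventually.of_forall fun n => by positivity) ?_ hlim
  filter_upwards [eventually_ne_atTop 0] with n hn
  have hn0 : (0 : ℝ) < n := by positivity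
  have hden : ρ * (n : ℝ) ^ κ ≤ n * ρ ^ logRounds τ n := by
    rw [hκ_def, Real.rpow_add_one hn0.ne', ← mul_assoc, mul_comm (n : ℝ)]
    gcongr
    exact mul_rpow_le_pow_logRounds hρ hρ1 hτ.le hn
  exact div_le_div₀ ((Nat.cast_nonneg _).trans (logRounds_le hτ.le n)) (logRounds_le hτ.le n)
    (by positivity) hden

end LogRounds

/-! ### Upper bound on the runtime -/

theorem exists_pos_le_mul_one_sub_sqrt {a c : ℝ} (hac : a < c) :
    ∃ η : ℝ, 0 < η ∧ η ≤ 1 / 2 ∧ a ≤ c * (1 - √(2 * η) - 3 * η) := by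
  have hlim : Tendsto (fun η : ℝ => c * (1 - √(2 * η) - 3 * η)) (𝓝 0) (𝓝 c) :=
    Continuous.tendsto' (by fun_prop) _ _ (by simp)
  exact ((eventually_le_nhds (by norm_num)).and
    (hlim.eventually (eventually_ge_nhds hac))).exists_gt

theorem exists_nat_add_four_div_le {w x y : ℝ} (hw : 0 < w) (hxy : x < y) :
    ∃ K : ℕ, 0 < K ∧ x + 4 / (w ^ 2 * K) ≤ y := by
  have hlim : Tendsto (fun K : ℕ => x + 4 / (w ^ 2 * K)) atTop (𝓝 (x + 0)) :=
    (tendsto_const_nhds.div_atTop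
      (tendsto_natCast_atTop_atTop.const_mul_atTop (by positivity))).const_add x
  rw [add_zero] at hlim
  exact ((eventually_gt_atTop 0).and (hlim.eventually (eventually_le_nhds hxy))).exists

theorem exists_startup_parameters {c L : ℝ} (hc : 0 < c) (hL0 : 0 < L)
    (hL : L < Real.log (1 + c)) :
    ∃ (b w η s : ℝ) (K : ℕ), 0 ≤ b ∧ 0 < w ∧ 0 < η ∧ η ≤ 1 / 2 ∧ 0 < s ∧ 0 < K ∧
      b + w ≤ c * (1 - √(2 * η) - 3 * η) ∧
      (1 + b) ^ (-s) + 4 / (w ^ 2 * K) ≤ Real.exp (-(s * L)) ∧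
      1 - (b + w) ^ 2 / 80 ≤ Real.exp (-(s * L)) := by
  obtain ⟨M, hLM, hMc⟩ := exists_between hL
  set b := Real.exp M - 1 with hb_def
  have hb : 0 < b := by linarith [Real.add_one_le_exp M]
  have hbc : b < c := by linarith [(Real.lt_log_iff_exp_lt (by linarith)).1 hMc]
  set w := (c - b) / 2 with hw_def
  have hw : 0 < w := by linarith
  obtain ⟨η, hη0, hη1, hη⟩ := exists_pos_le_mul_one_sub_sqrt (show b + w < c by linarith)
  set s := (b + w) ^ 2 / 80 / L
  have hs : 0 < s := by positivity
  have hsL : s * L = (b + w) ^ 2 / 80 := div_mul_cancel₀ _ hL0.ne'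
  have hlt : (1 + b) ^ (-s) < Real.exp (-(s * L)) := by
    rw [hb_def, add_sub_cancel, ← Real.exp_mul, Real.exp_lt_exp]
    nlinarith
  obtain ⟨K, hK0, hK⟩ := exists_nat_add_four_div_le hw hlt
  refine ⟨b, w, η, s, K, hb.le, hw, hη0, hη1, hs, hK0, hη, hK, ?_⟩
  rw [hsL]
  exact Real.one_sub_le_exp_neg _

section Upper

variable {G : ∀ n : ℕ, SimpleGraph (Fin n)} [∀ n, DecidableRel (G n).Adj]
  {P : Protocol} {q : unitInterval} {τ : ℝ}

theorem IsExpanderSequence.eventually_probAfter_card_le_le (hG : IsExpanderSequence G)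
    (hq : 0 < (q : ℝ)) (hτ : 1 / Real.log (1 + growthRate P q) < τ) :
    ∃ η > 0, ∀ ε > 0, ∀ᶠ n in atTop, ∀ v,
      probAfter (G n) P q (logRounds τ n) {J | (J.card : ℝ) ≤ η * n} {v} ≤ ε := by
  have hlog := log_one_add_growthRate_pos P hq
  have hτ0 : 0 < τ := (one_div_pos.2 hlog).trans hτ
  obtain ⟨L, hτL, hL⟩ := exists_between ((one_div_lt hlog hτ0).1 hτ)
  have hL0 : 0 < L := (one_div_pos.2 hτ0).trans hτL
  obtain ⟨b, w, η, s, K, hb, hw, hη0, hη1, hs, hK, hbw, hlarge, hsmall⟩ :=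
    exists_startup_parameters (growthRate_pos P hq) hL0 hL
  refine ⟨η, hη0, fun ε hε => ?_⟩
  have hκ : 0 < s * (L * τ - 1) := mul_pos hs (sub_pos.2 ((div_lt_iff₀ hτ0).1 hτL))
  have hlim := (tendsto_natCast_rpow_neg hκ).const_mul ((K : ℝ) ^ s * 2 ^ K)
  rw [mul_zero] at hlim
  filter_upwards [hG.eventually_isQuasirandom hη0, hlim.eventually (eventually_le_nhds hε),
    eventually_ne_atTop 0] with n hQ hle hn v
  have hn0 : (0 : ℝ) < n := by positivity
  have hpow : Real.exp (-(s * L)) ^ logRounds τ n ≤ (n : ℝ) ^ (τ * -(s * L)) := by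
    refine (pow_logRounds_le_rpow (Real.exp_pos _) ?_ hn).trans_eq (by rw [Real.log_exp])
    exact Real.exp_le_one_iff.2 (neg_nonpos.2 (by positivity))
  have hprob := hQ.probAfter_card_le_le hη1 hK hs.le hb hw hbw hlarge hsmall v (logRounds τ n)
  rw [Fintype.card_fin, Real.mul_rpow (Nat.cast_nonneg K) hn0.le] at hprob
  calc probAfter (G n) P q (logRounds τ n) {J | (J.card : ℝ) ≤ η * n} {v}
      ≤ (K : ℝ) ^ s * (n : ℝ) ^ s * (Real.exp (-(s * L)) ^ logRounds τ n * 2 ^ K) := hprob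
    _ ≤ (K : ℝ) ^ s * (n : ℝ) ^ s * ((n : ℝ) ^ (τ * -(s * L)) * 2 ^ K) := by gcongr
    _ = (K : ℝ) ^ s * 2 ^ K * (n : ℝ) ^ (-(s * (L * τ - 1))) := by
        rw [show -(s * (L * τ - 1)) = s + τ * -(s * L) by ring, Real.rpow_add hn0]
        ring
    _ ≤ ε := hle

theorem one_sub_growthRate_mul_mem_Ico (hq : 0 < (q : ℝ)) {η : ℝ} (hη : 0 < η) :
    1 - growthRate P q / 6 * (1 - √(1 - η / 2)) ∈ Set.Ico (0 : ℝ) 1 := by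
  have hc := growthRate_pos P hq
  have hsqrt : √(1 - η / 2) < 1 := (Real.sqrt_lt' one_pos).2 (by linarith)
  have hpos : 0 < growthRate P q / 6 * (1 - √(1 - η / 2)) :=
    mul_pos (by positivity) (sub_pos.2 hsqrt)
  have hle : growthRate P q / 6 * (1 - √(1 - η / 2)) ≤ 1 :=
    mul_le_one₀ (by linarith [growthRate_le_two P q.2]) (sub_nonneg.2 hsqrt.le)
      (sub_le_self 1 (Real.sqrt_nonneg _))
  exact ⟨sub_nonneg.2 hle, sub_lt_self 1 hpos⟩

theorem IsExpanderSequence.eventually_probAfter_lt_card_compl_le (hG : IsExpanderSequence G)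
    (hq : 0 < (q : ℝ)) (hτ : 0 < τ) {η₀ η₁ ε : ℝ} (hη₀ : 0 < η₀) (hη₁ : 0 < η₁) (hε : 0 < ε) :
    ∀ᶠ n in atTop, ∀ I : Finset (Fin n), η₀ * n < I.card →
      probAfter (G n) P q (logRounds τ n) {J | η₁ * n < Jᶜ.card} I ≤ ε := by
  set ρ := 1 - growthRate P q / 6 * (1 - √(1 - η₀ / 2))
  have hρ : ρ ∈ Set.Ico (0 : ℝ) 1 := one_sub_growthRate_mul_mem_Ico hq hη₀
  have hlim := ((tendsto_pow_atTop_nhds_zero_of_lt_one hρ.1 hρ.2).comp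
    (tendsto_logRounds hτ)).mul_const (1 / η₁)
  rw [zero_mul] at hlim
  filter_upwards [hG.eventually_isQuasirandom (η := min 1 (η₀ / 2)) (by positivity),
    hlim.eventually (eventually_le_nhds hε), eventually_ne_atTop 0] with n hQ hle hn I hI
  have hn0 : (0 : ℝ) < n := by positivity
  have hupper : IsUpperSet {J : Finset (Fin n) | η₀ * n < J.card} :=
    fun J J' hJJ' (hJ : η₀ * n < J.card) => show η₀ * n < J'.card from
      hJ.trans_le (Nat.cast_le.2 (Finset.card_le_card hJJ'))
  have hstep (J : Finset (Fin n)) (hJ : η₀ * n < J.card) :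
      meanUninformed (G n) P q J ≤ ρ * Jᶜ.card := by
    refine hQ.meanUninformed_le_of_dense (min_le_left _ _) (min_le_right _ _) ?_
    have hcard := card_add_card_compl_cast J
    rw [Fintype.card_fin] at hcard ⊢
    linarith
  refine (probAfter_le_pow_mul_card_div hupper hρ.1 (mul_pos hη₁ hn0) hQ.degree_pos hstep hI
    (fun J hJ => le_of_lt hJ) _).trans (le_of_eq_of_le ?_ hle)
  rw [Fintype.card_fin, Function.comp_apply]
  field_simp

theorem IsExpanderSequence.eventually_probAfter_compl_univ_le (hG : IsExpanderSequence G)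
    (hq : 0 < (q : ℝ)) (hτ0 : 0 < τ) (hτ : 1 / -Real.log (shrinkRate P q) < τ) :
    ∃ η > 0, ∀ ε > 0, ∀ᶠ n in atTop, ∀ I : Finset (Fin n), (Iᶜ.card : ℝ) ≤ η * n →
      probAfter (G n) P q (logRounds τ n) {Finset.univ}ᶜ I ≤ ε := by
  have hρ0 := shrinkRate_nonneg P q.2
  have hρ := lt_exp_neg_one_div_of_one_div_neg_log_lt hρ0 (shrinkRate_lt_one P hq) hτ0 hτ
  have hlim : Tendsto (fun η : ℝ => shrinkRate P q + η + 2 * √(2 * η)) (𝓝 0)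
      (𝓝 (shrinkRate P q)) := Continuous.tendsto' (by fun_prop) _ _ (by simp)
  obtain ⟨η, hη0, hη⟩ := (hlim.eventually (eventually_lt_nhds hρ)).exists_gt
  set ρ := shrinkRate P q + η + 2 * √(2 * η)
  have hρ_pos : 0 < ρ := by positivity
  refine ⟨η, hη0, fun ε hε => ?_⟩
  filter_upwards [hG.eventually_isQuasirandom hη0,
    (tendsto_pow_logRounds_mul hρ_pos hτ0 hη).eventually (eventually_le_nhds hε)] with n hQ hle I hI
  have hupper : IsUpperSet {J : Finset (Fin n) | (Jᶜ.card : ℝ) ≤ η * n} :=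
    fun J J' hJJ' (hJ : (Jᶜ.card : ℝ) ≤ η * n) => show (J'ᶜ.card : ℝ) ≤ η * n from
      (Nat.cast_le.2 (Finset.card_le_card (Finset.compl_subset_compl.2 hJJ'))).trans hJ
  have hone_le (J : Finset (Fin n)) (hJ : J ≠ Finset.univ) : (1 : ℝ) ≤ Jᶜ.card :=
    Nat.one_le_cast.2 (Finset.card_pos.2
      (Finset.nonempty_iff_ne_empty.2 (mt (Finset.compl_eq_empty_iff J).1 hJ)))
  refine (probAfter_le_pow_mul_card_div hupper hρ_pos.le one_pos hQ.degree_pos (fun J hJ =>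
    hQ.meanUninformed_le_of_card_compl_le (by rwa [Fintype.card_fin])) hI hone_le _).trans ?_
  rwa [Fintype.card_fin, div_one]

theorem eventually_logRounds_add_le_floor {τ₁ τ₂ τ₃ : ℝ} (hτ₁ : 0 ≤ τ₁) (hτ₂ : 0 ≤ τ₂)
    (hτ₃ : 0 ≤ τ₃) (hτ : τ₁ + τ₂ + τ₃ < τ) :
    ∀ᶠ n in atTop, logRounds τ₁ n + (logRounds τ₂ n + logRounds τ₃ n) ≤ ⌊τ * Real.log n⌋₊ := by
  filter_upwards [(tendsto_log_natCast_atTop.const_mul_atTop (sub_pos.2 hτ)).eventually_ge_atTop 3]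
    with n hn
  refine Nat.le_floor ?_
  push_cast
  linarith [logRounds_le hτ₁ n, logRounds_le hτ₂ n, logRounds_le hτ₃ n]

theorem IsExpanderSequence.eventually_informed_ne_univ_le (hG : IsExpanderSequence G)
    (hq : 0 < (q : ℝ)) (hτ : runtimeConst P q < τ) {ε : ℝ} (hε : 0 < ε) :
    ∀ᶠ n in atTop, ∀ v, (processLaw (G n) q).real
      {ω | informed P v ω ⌊τ * Real.log n⌋₊ ≠ Finset.univ} ≤ ε := by
  rw [runtimeConst_eq P q.2.2] at hτ
  have hA : 0 < 1 / Real.log (1 + growthRate P q) :=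
    one_div_pos.2 (log_one_add_growthRate_pos P hq)
  have hB : 0 ≤ 1 / -Real.log (shrinkRate P q) := one_div_neg_log_shrinkRate_nonneg P hq q.2.2
  set A := 1 / Real.log (1 + growthRate P q)
  set B := 1 / -Real.log (shrinkRate P q)
  set γ := (τ - (A + B)) / 4 with hγ_def
  have hγ : 0 < γ := by linarith
  have hε3 : 0 < ε / 3 := by positivity
  obtain ⟨η₀, hη₀, hstart⟩ := hG.eventually_probAfter_card_le_le hq (lt_add_of_pos_right A hγ)
  obtain ⟨η₁, hη₁, hend⟩ := hG.eventually_probAfter_compl_univ_le hq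
    (add_pos_of_nonneg_of_pos hB hγ) (lt_add_of_pos_right B hγ)
  filter_upwards [hstart _ hε3, hend _ hε3,
    hG.eventually_probAfter_lt_card_compl_le (P := P) hq hγ hη₀ hη₁ hε3,
    eventually_logRounds_add_le_floor (τ₁ := A + γ) (τ₂ := γ) (τ₃ := B + γ) (τ := τ)
      (by positivity) hγ.le (by positivity) (by linarith)] with n hstart_n hend_n hdense_n hT v
  have hcompl₀ : {J : Finset (Fin n) | η₀ * n < J.card}ᶜ = {J | (J.card : ℝ) ≤ η₀ * n} := by
    ext J; simp
  have hcompl₁ : {J : Finset (Fin n) | (Jᶜ.card : ℝ) ≤ η₁ * n}ᶜ = {J | η₁ * n < Jᶜ.card} := by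
    ext J; simp
  calc (processLaw (G n) q).real {ω | informed P v ω ⌊τ * Real.log n⌋₊ ≠ Finset.univ}
      ≤ (processLaw (G n) q).real {ω | informed P v ω
          (logRounds (A + γ) n + (logRounds γ n + logRounds (B + γ) n)) ∈
            ({Finset.univ}ᶜ : Set (Finset (Fin n)))} :=
        measureReal_mono fun ω hω huniv =>
          hω (Finset.univ_subset_iff.1 (huniv ▸ informed_mono P v ω hT))
    _ ≤ (ε / 3 + ε / 3) + ε / 3 := by
        rw [processLaw_real_informed_mem]
        refine (probAfter_add_le (B := {J | η₀ * n < J.card}) (by positivity)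
          fun J _ hJ => ?_).trans (add_le_add_right (hcompl₀ ▸ hstart_n v) _)
        exact (probAfter_add_le (B := {J | (Jᶜ.card : ℝ) ≤ η₁ * n}) hε3.le
          fun J' _ hJ' => hend_n J' hJ').trans (add_le_add_right (hcompl₁ ▸ hdense_n J hJ) _)
    _ = ε := add_thirds ε

end Upper

/-! ### Lower bound on the runtime -/

section Lower

variable {G : ∀ n : ℕ, SimpleGraph (Fin n)} [∀ n, DecidableRel (G n).Adj]
  {P : Protocol} {q : unitInterval} {τ ε : ℝ}

theorem IsExpanderSequence.eventually_probAfter_half_lt_card_le (hG : IsExpanderSequence G)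
    (hq : 0 < (q : ℝ)) (hτ0 : 0 < τ) (hτ : τ < 1 / Real.log (1 + growthRate P q)) (hε : 0 < ε) :
    ∀ᶠ n in atTop, ∀ v,
      probAfter (G n) P q (logRounds τ n) {J | (n : ℝ) / 2 < J.card} {v} ≤ ε := by
  have hc := growthRate_pos P hq
  set c := growthRate P q
  have hc_lt : 1 + c < Real.exp (1 / τ) := (Real.log_lt_iff_lt_exp (by positivity)).1
    ((lt_one_div hτ0 (log_one_add_growthRate_pos P hq)).1 hτ)
  have hcont : Tendsto (fun η : ℝ => 1 + c * (1 + η)) (𝓝 0) (𝓝 (1 + c)) :=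
    Continuous.tendsto' (by fun_prop) _ _ (by simp)
  obtain ⟨η, hη0, hη⟩ := (hcont.eventually (eventually_lt_nhds hc_lt)).exists_gt
  have hone_le : 1 ≤ 1 + c * (1 + η) := le_add_of_nonneg_right (by positivity)
  have hlim := (tendsto_pow_logRounds_div hone_le hτ0 hη).const_mul 2
  rw [mul_zero] at hlim
  filter_upwards [hG.eventually_isQuasirandom hη0, hlim.eventually (eventually_le_nhds hε),
    eventually_ne_atTop 0] with n hQ hle hn v
  have hmarkov : (n : ℝ) / 2 * probAfter (G n) P q (logRounds τ n) {J | (n : ℝ) / 2 < J.card} {v} ≤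
      (1 + c * (1 + η)) ^ logRounds τ n :=
    calc _ ≤ (transition (G n) P q ^ logRounds τ n) (fun J => (J.card : ℝ)) {v} :=
          mul_probAfter_le_transition_pow (fun _ => Nat.cast_nonneg _) (fun J hJ => le_of_lt hJ) _
      _ ≤ (1 + c * (1 + η)) ^ logRounds τ n * ({v} : Finset (Fin n)).card :=
          hQ.transition_pow_card_le _
      _ = (1 + c * (1 + η)) ^ logRounds τ n := by rw [Finset.card_singleton, Nat.cast_one, mul_one]
  refine le_trans ?_ hle
  rw [← le_div_iff₀' (by positivity)] at hmarkov
  exact hmarkov.trans_eq (by ring)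

theorem exists_lt_one_sub_pullRate_mul_exp {p : ℝ} (hp : p < shrinkRate P q) :
    ∃ η : ℝ, 0 < η ∧ η < 1 ∧
      p < (1 - pullRate P q) * Real.exp (-(pushRate P q * ((1 + η) / (1 - η)))) := by
  have hcont : ContinuousAt (fun η : ℝ => (1 - pullRate P q) *
      Real.exp (-(pushRate P q * ((1 + η) / (1 - η))))) 0 := by
    have hratio : ContinuousAt (fun η : ℝ => (1 + η) / (1 - η)) 0 :=
      ContinuousAt.div (by fun_prop) (by fun_prop) (by simp)
    fun_prop
  exact ((eventually_lt_nhds one_pos).and (hcont.eventually (eventually_gt_nhds (by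
    simpa [shrinkRate] using hp)))).exists_gt

theorem one_sub_pullRate_mul_exp_le_one {η : ℝ} (hη0 : 0 < η) (hη1 : η < 1) :
    (1 - pullRate P q) * Real.exp (-(pushRate P q * ((1 + η) / (1 - η)))) ≤ 1 := by
  have hpush := (pushRate_mem_Icc P q.2).1
  have : 0 < 1 - η := sub_pos.2 hη1
  exact mul_le_one₀ (sub_le_self 1 (pullRate_mem_Icc P q.2).1) (Real.exp_nonneg _)
    (Real.exp_le_one_iff.2 (neg_nonpos.2 (by positivity)))

theorem IsExpanderSequence.eventually_probAfter_univ_le_of_half (hG : IsExpanderSequence G)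
    (hq : 0 < (q : ℝ)) (hρ : 0 < shrinkRate P q) (hτ0 : 0 < τ)
    (hτ : τ < 1 / -Real.log (shrinkRate P q)) (hε : 0 < ε) :
    ∀ᶠ n in atTop, ∀ I : Finset (Fin n), (I.card : ℝ) ≤ n / 2 →
      probAfter (G n) P q (logRounds τ n) {Finset.univ} I ≤ ε := by
  have hρ1 := shrinkRate_lt_one P hq
  obtain ⟨p₁, hp₁, hp₁ρ⟩ :=
    exists_between (exp_neg_one_div_lt_of_lt_one_div_neg_log hρ hρ1 hτ0 hτ)
  have hp₁0 : 0 < p₁ := (Real.exp_pos _).trans hp₁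
  obtain ⟨η, hη0, hη1, hp⟩ := exists_lt_one_sub_pullRate_mul_exp hp₁ρ
  set p₀ := (1 - pullRate P q) * Real.exp (-(pushRate P q * ((1 + η) / (1 - η))))
  have hp₀1 : p₀ ≤ 1 := one_sub_pullRate_mul_exp_le_one hη0 hη1
  have hlim := (tendsto_logRounds_div_mul_pow_logRounds hp₁0 (hp₁ρ.trans hρ1).le hτ0 hp₁).const_mul
    (2 / (p₀ - p₁) ^ 2)
  rw [mul_zero] at hlim
  filter_upwards [hG.eventually_isQuasirandom hη0, hlim.eventually (eventually_le_nhds hε),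
    eventually_ne_atTop 0] with n hQ hle hn I hI
  have hcompl : (n : ℝ) / 2 ≤ Iᶜ.card := by
    have hcard := card_add_card_compl_cast I
    rw [Fintype.card_fin] at hcard
    linarith
  refine (probAfter_univ_le hQ.degree_pos hp₁0 hp hp₀1 (m := n / 2 * p₁ ^ logRounds τ n)
    (by positivity) (fun I u _ => hQ.le_stayProb hη1 u) _ (by gcongr)).trans
      (le_of_eq_of_le ?_ hle)
  field_simp

theorem eventually_probAfter_zero_univ_le_of_half (hε : 0 < ε) :
    ∀ᶠ n in atTop, ∀ I : Finset (Fin n), (I.card : ℝ) ≤ n / 2 →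
      probAfter (G n) P q 0 {Finset.univ} I ≤ ε := by
  filter_upwards [eventually_ne_atTop 0] with n hn I hI
  have hn0 : (0 : ℝ) < n := by positivity
  have hI_ne : I ≠ Finset.univ := by
    rintro rfl
    rw [Finset.card_univ, Fintype.card_fin] at hI
    linarith
  simpa [probAfter, hI_ne] using hε.le

theorem IsExpanderSequence.exists_eventually_probAfter_univ_le (hG : IsExpanderSequence G)
    (hq : 0 < (q : ℝ)) (hτ : τ < runtimeConst P q) (hε : 0 < ε) :
    ∃ τ₁ τ₂ : ℝ, 0 < τ₁ ∧ τ₁ < 1 / Real.log (1 + growthRate P q) ∧ τ ≤ τ₁ + τ₂ ∧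
      ∀ᶠ n in atTop, ∀ I : Finset (Fin n), (I.card : ℝ) ≤ n / 2 →
        probAfter (G n) P q (logRounds τ₂ n) {Finset.univ} I ≤ ε := by
  rw [runtimeConst_eq P q.2.2] at hτ
  have hA : 0 < 1 / Real.log (1 + growthRate P q) :=
    one_div_pos.2 (log_one_add_growthRate_pos P hq)
  set A := 1 / Real.log (1 + growthRate P q)
  obtain hρ | hρ := (shrinkRate_nonneg P q.2).eq_or_lt
  · rw [← hρ, Real.log_zero, neg_zero, div_zero, add_zero] at hτ
    refine ⟨max τ (A / 2), 0, by positivity, max_lt hτ (half_lt_self hA), by simp, ?_⟩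
    simpa [logRounds] using eventually_probAfter_zero_univ_le_of_half hε
  · have hB : 0 < 1 / -Real.log (shrinkRate P q) :=
      one_div_pos.2 (neg_pos.2 (Real.log_neg hρ (shrinkRate_lt_one P hq)))
    set B := 1 / -Real.log (shrinkRate P q)
    refine ⟨max (A - (A + B - τ) / 2) (A / 2), max (B - (A + B - τ) / 2) (B / 2), by positivity,
      max_lt (by linarith) (half_lt_self hA), ?_,
      hG.eventually_probAfter_univ_le_of_half hq hρ (by positivity)
        (max_lt (by linarith : B - (A + B - τ) / 2 < B) (half_lt_self hB)) hε⟩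
    linarith [le_max_left (A - (A + B - τ) / 2) (A / 2),
      le_max_left (B - (A + B - τ) / 2) (B / 2)]

theorem IsExpanderSequence.eventually_informed_eq_univ_le (hG : IsExpanderSequence G)
    (hq : 0 < (q : ℝ)) (hτ : τ < runtimeConst P q) (hε : 0 < ε) :
    ∀ᶠ n in atTop, ∀ v, (processLaw (G n) q).real
      {ω | informed P v ω ⌊τ * Real.log n⌋₊ = Finset.univ} ≤ ε := by
  obtain ⟨τ₁, τ₂, hτ₁0, hτ₁, hle, hend⟩ :=
    hG.exists_eventually_probAfter_univ_le hq hτ (half_pos hε)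
  filter_upwards [hG.eventually_probAfter_half_lt_card_le hq hτ₁0 hτ₁ (half_pos hε), hend]
    with n hstart_n hend_n v
  have hT : ⌊τ * Real.log n⌋₊ ≤ logRounds τ₁ n + logRounds τ₂ n := by
    refine Nat.floor_le_of_le ?_
    push_cast
    linarith [le_logRounds τ₁ n, le_logRounds τ₂ n,
      mul_le_mul_of_nonneg_right hle (Real.log_natCast_nonneg n)]
  have hcompl : {J : Finset (Fin n) | (J.card : ℝ) ≤ n / 2}ᶜ = {J | (n : ℝ) / 2 < J.card} := by
    ext J; simp
  calc (processLaw (G n) q).real {ω | informed P v ω ⌊τ * Real.log n⌋₊ = Finset.univ}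
      ≤ (processLaw (G n) q).real {ω | informed P v ω (logRounds τ₁ n + logRounds τ₂ n) ∈
          ({Finset.univ} : Set (Finset (Fin n)))} :=
        measureReal_mono fun ω (hω : informed P v ω _ = _) =>
          Finset.univ_subset_iff.1 (hω ▸ informed_mono P v ω hT)
    _ ≤ ε / 2 + ε / 2 := by
        rw [processLaw_real_informed_mem]
        exact (probAfter_add_le (B := {J | (J.card : ℝ) ≤ n / 2}) (half_pos hε).le
          fun J _ hJ => hend_n J hJ).trans (add_le_add_right (hcompl ▸ hstart_n v) _)
    _ = ε := add_halves ε

end Lower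

/-! ### Concentration of the runtime -/

section Runtime

variable {V : Type*} [Fintype V] [DecidableEq V] {P : Protocol} {v : V} {ω : ℕ → Round V}

theorem runtime_eq_of_isLeast {t : ℕ} (h : IsLeast {t | informed P v ω t = Finset.univ} t) :
    runtime P v ω = t :=
  le_antisymm (iInf₂_le t h.1) (le_iInf₂ fun _ hs => Nat.cast_le.2 (h.2 hs))

theorem exists_runtime_eq {t₀ t₁ : ℕ} (h₀ : informed P v ω t₀ ≠ Finset.univ)
    (h₁ : informed P v ω t₁ = Finset.univ) : ∃ t : ℕ, runtime P v ω = t ∧ t₀ < t ∧ t ≤ t₁ := by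
  classical
  have hex : ∃ t, informed P v ω t = Finset.univ := ⟨t₁, h₁⟩
  refine ⟨Nat.find hex, runtime_eq_of_isLeast ⟨Nat.find_spec hex, fun _ => Nat.find_min' hex⟩,
    lt_of_not_ge fun hle => h₀ (Finset.univ_subset_iff.1 ?_), Nat.find_min' hex h₁⟩
  exact (Nat.find_spec hex).ge.trans (informed_mono P v ω hle)

/-- The event that the runtime is finite and differs from `x` by at most `r`. -/
def runtimeNear (P : Protocol) (v : V) (x r : ℝ) : Set (ℕ → Round V) :=
  {ω | ∃ t : ℕ, runtime P v ω = t ∧ |(t : ℝ) - x| ≤ r}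

theorem runtimeNear_mono {x r r' : ℝ} (h : r ≤ r') :
    runtimeNear P v x r ⊆ runtimeNear P v x r' :=
  fun _ ⟨t, ht, htr⟩ => ⟨t, ht, htr.trans h⟩

theorem compl_runtimeNear_subset {x r : ℝ} (h : 0 ≤ x + r) :
    (runtimeNear P v x r)ᶜ ⊆ {ω | informed P v ω ⌊x + r⌋₊ ≠ Finset.univ} ∪
      {ω | informed P v ω ⌊x - r⌋₊ = Finset.univ} := by
  intro ω hω
  by_contra hnot
  simp only [Set.mem_union, Set.mem_ofPred_eq, not_or, not_not] at hnot
  obtain ⟨t, ht, hlt, hle⟩ := exists_runtime_eq hnot.2 hnot.1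
  have hlower : x - r < t := (Nat.floor_lt' (Nat.ne_zero_of_lt hlt)).1 hlt
  have hupper : (t : ℝ) ≤ x + r := (Nat.le_floor_iff h).1 hle
  exact hω ⟨t, ht, abs_le.2 ⟨by linarith, by linarith⟩⟩

end Runtime

theorem IsExpanderSequence.eventually_le_processLaw_runtimeNear {G : ∀ n : ℕ, SimpleGraph (Fin n)}
    [∀ n, DecidableRel (G n).Adj] (hG : IsExpanderSequence G) {q : unitInterval}
    (hq : 0 < (q : ℝ)) (P : Protocol) {ε : ℝ} (hε : 0 < ε) :
    ∀ᶠ n in atTop, ∀ v, 1 - ENNReal.ofReal ε ≤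
      processLaw (G n) q (runtimeNear P v (runtimeConst P q * Real.log n) (ε * Real.log n)) := by
  filter_upwards [
    hG.eventually_informed_ne_univ_le hq (lt_add_of_pos_right (runtimeConst P q) hε) (half_pos hε),
    hG.eventually_informed_eq_univ_le hq (sub_lt_self (runtimeConst P q) hε) (half_pos hε)]
    with n hupper hlower v
  set x := runtimeConst P q * Real.log n
  set r := ε * Real.log n
  have hnonneg : 0 ≤ x + r := by
    have := runtimeConst_pos P hq q.2.2
    have := Real.log_natCast_nonneg n
    positivity
  have hcompl : processLaw (G n) q (runtimeNear P v x r)ᶜ ≤ ENNReal.ofReal ε := by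
    rw [ENNReal.le_ofReal_iff_toReal_le (measure_ne_top _ _) hε.le, ← measureReal_def]
    refine (measureReal_mono (compl_runtimeNear_subset hnonneg)).trans
      ((measureReal_union_le _ _).trans ?_)
    rw [← add_mul, ← sub_mul]
    linarith [hupper v, hlower v]
  rw [tsub_le_iff_right, ← measure_univ (μ := processLaw (G n) q)]
  exact (measure_univ_le_add_compl _).trans (add_le_add_right hcompl _)

theorem exists_tendsto_zero_eventually {D : ℕ → ℝ → Prop}
    (hmono : ∀ n ε ε', ε ≤ ε' → D n ε → D n ε') (hD : ∀ ε > 0, ∀ᶠ n in atTop, D n ε) :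
    ∃ e : ℕ → ℝ, Tendsto e atTop (𝓝 0) ∧ ∀ᶠ n in atTop, D n (e n) := by
  set S : ℕ → Set ℝ := fun n => {ε | 0 < ε ∧ D n ε}
  have hbdd (n : ℕ) : BddBelow (S n) := ⟨0, fun ε hε => hε.1.le⟩
  have hnonneg (n : ℕ) : 0 ≤ sInf (S n) := Real.sInf_nonneg fun ε hε => hε.1.le
  have hinf : Tendsto (fun n => sInf (S n)) atTop (𝓝 0) := by
    refine tendsto_order.2 ⟨fun a ha => Eventually.of_forall fun n => ha.trans_le (hnonneg n),
      fun a ha => ?_⟩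
    filter_upwards [hD (a / 2) (half_pos ha)] with n hn
    exact (csInf_le (hbdd n) ⟨half_pos ha, hn⟩).trans_lt (half_lt_self ha)
  refine ⟨fun n => sInf (S n) + 1 / ((n : ℝ) + 1),
    by simpa using hinf.add tendsto_one_div_add_atTop_nhds_zero_nat, ?_⟩
  filter_upwards [hD 1 one_pos] with n hn
  obtain ⟨ε, hε, hlt⟩ := Real.lt_sInf_add_pos (s := S n) ⟨1, one_pos, hn⟩
    (ε := 1 / ((n : ℝ) + 1)) (by positivity)
  exact hmono n ε _ hlt.le hε.2

theorem tendsto_iInf_measure_one {Ω : ℕ → Type*} [∀ n, MeasurableSpace (Ω n)]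
    {μ : ∀ n, Measure (Ω n)} [∀ n, IsProbabilityMeasure (μ n)] {E : ∀ n, Fin n → Set (Ω n)}
    {e : ℕ → ℝ} (he : Tendsto e atTop (𝓝 0))
    (hE : ∀ᶠ n in atTop, ∀ v, 1 - ENNReal.ofReal (e n) ≤ μ n (E n v)) :
    Tendsto (fun n => ⨅ v, μ n (E n v)) atTop (𝓝 1) := by
  have hofReal : Tendsto (fun n => ENNReal.ofReal (e n)) atTop (𝓝 0) := by
    simpa using ENNReal.tendsto_ofReal he
  have hlower : Tendsto (fun n => 1 - ENNReal.ofReal (e n)) atTop (𝓝 1) := by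
    simpa using ENNReal.Tendsto.sub tendsto_const_nhds hofReal (Or.inl ENNReal.one_ne_top)
  refine tendsto_of_tendsto_of_tendsto_of_le_of_le' hlower tendsto_const_nhds
    (hE.mono fun n => le_iInf) ?_
  filter_upwards [eventually_gt_atTop 0] with n hn
  exact (iInf_le _ (⟨0, hn⟩ : Fin n)).trans prob_le_one

end RumourSpreading

theorem mainTheorem2 (G : ∀ n : ℕ, SimpleGraph (Fin n)) [∀ n, DecidableRel (G n).Adj]
    (hG : RumourSpreading.IsExpanderSequence G) (q : ℝ) (hq0 : 0 < q) (hq1 : q ≤ 1)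
    (P : RumourSpreading.Protocol) :
    ∃ g : ℕ → ℝ, (g =o[atTop] fun n : ℕ => Real.log n) ∧
      Tendsto
        (fun n : ℕ => ⨅ v : Fin n, RumourSpreading.processLaw (G n) ⟨q, hq0.le, hq1⟩
          {ω | ∃ t : ℕ, RumourSpreading.runtime P v ω = t ∧
            |(t : ℝ) - RumourSpreading.runtimeConst P q * Real.log n| ≤ g n})
        atTop (𝓝 1) := by
  obtain ⟨e, he, hprob⟩ := RumourSpreading.exists_tendsto_zero_eventually
    (fun n ε ε' hle h v => (tsub_le_tsub_left (ENNReal.ofReal_le_ofReal hle) 1).trans <|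
      (h v).trans <| measure_mono <| RumourSpreading.runtimeNear_mono <|
        mul_le_mul_of_nonneg_right hle (Real.log_natCast_nonneg n))
    fun ε hε => hG.eventually_le_processLaw_runtimeNear (q := ⟨q, hq0.le, hq1⟩) hq0 P hε
  refine ⟨fun n => e n * Real.log n, ?_, RumourSpreading.tendsto_iInf_measure_one he hprob⟩
  simpa using ((isLittleO_one_iff ℝ).2 he).mul_isBigO
    (isBigO_refl (fun n : ℕ => Real.log n) atTop)
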